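/- **Setting.** Let $(Y_i)_{i\ge1}$ be random variables such that the functions $U_i(x)=-\log \mathsf P(|Y_i|\ge x)$ are finite and convex on $[0,\infty)$ with $U_i(1)=1$. Put $\hat U_i(x)=x^2$ for $|x|\le 1$, $\hat U_i(x)=2U_i(|x|)-1$ for $|x|\ge1$, and for $u>0$, $t\in\ell^2$, $$\mathcal N_u(t)=\sup\Big\{\sum_i t_ia_i:\ \sum_i\hat U_i(a_i)\le u\Big\},\qquad B(u)=\{t\in \ell^2:\mathcal N_u(t)\le u\}.$$ Fix integers $\kappa\ge5$, $\sigma\ge0$ and let $r=2^{\kappa-3}$. For $j\in\mathbb Z$ let $$\varphi_j(s,t)=\inf\{u>0:\ s-t\in r^{-j}B(u)\}\in[0,\infty].$$ Let $N_0=1$, $N_n=2^{2^n}$ $(n\ge1)$, and $j_n(A)=\sup\{j\in\mathbb Z:\varphi_j(x,y)\le2^n\ \forall x,y\in A\}$. Let $T\subset\ell^2$ be finite, $N(T)=|T|\ge2$, with a fixed enumeration. Let $B_j(x,c)=\{y\in T:\varphi_j(x,y)\le c\}$ and $4B_j(x,c)=\{y\in T:\varphi_j(x/4,y/4)\le c\}$.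 Let $j_0=j_0(T)$, let $n(T)$ be the smallest $n$ with $|T|\le N_n$, and let $j(T)$ be the smallest $j$ with $\varphi_j(x,y)>2^{n(T)}$ for all distinct $x,y\in T$. For $n\in\mathbb N$ and $j\ge j_0-\sigma-2$ define $f_{n,j}:T\to[0,\infty)$ by $f_{n,j}=0$ if $n>n(T)+\kappa$ or $j\ge j(T)+\sigma+3$, and otherwise recursively by $$f_{n,j}(u)=\max\{f_{n+\kappa,j+1}(u),\,A_{n,j}(u),\,f_{n,j+1}(u)\}.$$ Here $A_{n,j}(u)$ is obtained greedily: for $m=0,1,\dots,N_{n+\kappa}-1$ choose $$x_{m+1}\in B_{j+1}(u,2^n)\setminus\bigcup_{i\le m}4B_{j+\sigma+3}(x_i,2^{n+\kappa})$$ to be the first point in the enumeration that maximises $f_{n+\kappa,j+\sigma+3}$ on this set. If the set is empty for some $m<N_{n+\kappa}$, then $A_{n,j}(u)=0$; otherwise $A_{n,j}(u)=2^nr^{-j-\sigma-1}+f_{n+\kappa,j+\sigma+3}(x_{N_{n+\kappa}})$. **Model.** Programs are deterministic and run at unit cost on integer and real memory cells with indexed (array) access. The integer operations are addition, subtraction and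 comparison; the real operations are addition, comparison and $z\mapsto 2^z$ for $z\in\mathbb Z$. A program receives $N(T)$ and has access to the distances through unit-cost queries returning the integers $j_n(\{x,y\})$ and $j_n(\{x/4,y/4\})$ for $n\in\mathbb N$ and distinct $x,y\in T$. (For $x\ne y$, $\varphi_j(x,y)\le 2^n$ if and only if $j\le j_n(\{x,y\})$.) **Theorem.** For all $\kappa\ge5$ and $\sigma\ge0$ there are a polynomial $p$ and programs, depending only on $\kappa$ and $\sigma$, which for all $(Y_i)$ and $T$ as above compute exactly, in at most $p(N(T))$ steps, where $(n,j)$ ranges over the window $0\le n\le n(T)+\kappa$, $j_0-\sigma-2\le j\le j(T)+\sigma+3$: 1. the number $\sup_{u\in T}\sup_{(n,j)} f_{n,j}(u)$; 2. for a given $u\in T$, the number $\sup_{(n,j)} f_{n,j}(u)$; 3. for a given $(n,j)$ in the window and a given $u\in T$, the value $f_{n,j}(u)$. In particular, the running time does not depend on $j(T)$. -/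

import Mathlib

open Set MeasureTheory
open scoped ENNReal Pointwise

noncomputable section

namespace LogConcaveProcess

/-! ### The family of distances of a log-concave-tailed canonical process -/

/-- The space of square-summable real sequences. -/
abbrev Ell2 : Type := lp (fun _ : ℕ => ℝ) 2

/-- The function `x ↦ -log P(|Y| ≥ x)`. -/
def tailExponent {Ω : Type*} [MeasurableSpace Ω] (P : Measure Ω) (Y : Ω → ℝ) (x : ℝ) : ℝ :=
  -Real.log (P.real {ω | x ≤ |Y ω|})

/-- The modification of `U` that is quadratic on `[-1, 1]` and is `2 U(|x|) - 1` outside. -/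
def hatU (U : ℝ → ℝ) (x : ℝ) : ℝ :=
  if |x| ≤ 1 then x ^ 2 else 2 * U |x| - 1

/-- The values `∑ i, t i * a i` over all sequences `a` with `∑ i, hatU (U i) (a i) ≤ u`. -/
def dualValues (U : ℕ → ℝ → ℝ) (u : ℝ) (t : Ell2) : Set ℝ :=
  {v | ∃ a : ℕ → ℝ, Summable (fun i => hatU (U i) (a i)) ∧ ∑' i, hatU (U i) (a i) ≤ u ∧
    v = ∑' i, t i * a i}

/-- The functional `𝒩_u(t)`; for square-summable `t` and `u > 0` this is the supremum of
a non-empty bounded set. -/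
def dualNorm (U : ℕ → ℝ → ℝ) (u : ℝ) (t : Ell2) : ℝ :=
  sSup (dualValues U u t)

/-- The set `B(u) = {t | 𝒩_u(t) ≤ u}`. -/
def dualBall (U : ℕ → ℝ → ℝ) (u : ℝ) : Set Ell2 :=
  {t | dualNorm U u t ≤ u}

/-- `φ_j(s, t) = inf {u > 0 | s - t ∈ r^{-j} B(u)}`, with the value `∞` if there is no such `u`. -/
def phi (U : ℕ → ℝ → ℝ) (r : ℝ) (j : ℤ) (s t : Ell2) : ℝ≥0∞ :=
  ⨅ (u : ℝ) (_ : 0 < u) (_ : s - t ∈ (r ^ (-j)) • dualBall U u), ENNReal.ofReal u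

/-- `j_n(A) = sup {j ∈ ℤ | φ_j(x, y) ≤ 2^n for all x, y ∈ A}`. -/
def levelOf (U : ℕ → ℝ → ℝ) (r : ℝ) (n : ℕ) (A : Set Ell2) : ℤ :=
  sSup {j : ℤ | ∀ x ∈ A, ∀ y ∈ A, phi U r j x y ≤ 2 ^ n}

/-- `N_0 = 1` and `N_n = 2^(2^n)` for `n ≥ 1`. -/
def bigN (n : ℕ) : ℕ := if n = 0 then 1 else 2 ^ 2 ^ n

/-! ### The recursively defined functions `f_{n,j}` -/

section Functions

/-- The parameter `r = 2^(κ - 3)`. -/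
def ratio (κ : ℕ) : ℝ := 2 ^ (κ - 3)

variable (κ σ : ℕ) (U : ℕ → ℝ → ℝ) {N : ℕ} (T : Fin N → Ell2)

/-- `j_0(T)`: the largest `j` with `φ_j ≤ 1` on `T`. -/
def jLow : ℤ := levelOf U (ratio κ) 0 (Set.range T)

/-- `n(T)`: the smallest `n` with `|T| ≤ N_n`. -/
def nTop (N : ℕ) : ℕ := sInf {n : ℕ | N ≤ bigN n}

/-- `j(T)`: the smallest `j` with `φ_j(x, y) > 2^{n(T)}` for all distinct `x, y ∈ T`. -/
def jHigh : ℤ :=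
  sInf {j : ℤ | ∀ a b : Fin N, T a ≠ T b → 2 ^ nTop N < phi U (ratio κ) j (T a) (T b)}

open Classical in
/-- The (indices of the) points of `T` in the ball `B_j(T a, c)`. -/
def ballT (j : ℤ) (a : Fin N) (c : ℝ≥0∞) : Finset (Fin N) :=
  {b | phi U (ratio κ) j (T a) (T b) ≤ c}

open Classical in
/-- The (indices of the) points of `T` in the dilated ball `4 B_j(T a, c)`, that is,
the points `y` with `φ_j(T a / 4, y / 4) ≤ c`. -/
def ballT4 (j : ℤ) (a : Fin N) (c : ℝ≥0∞) : Finset (Fin N) :=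
  {b | phi U (ratio κ) j ((1 / 4 : ℝ) • T a) ((1 / 4 : ℝ) • T b) ≤ c}

open Classical in
/-- The first point of `S`, in the enumeration of `T`, at which `score` is maximal on `S`;
`none` if `S` is empty. -/
def firstMax (score : Fin N → ℝ) (S : Finset (Fin N)) : Option (Fin N) :=
  if h : ({x ∈ S | ∀ y ∈ S, score y ≤ score x} : Finset (Fin N)).Nonempty then
    some (Finset.min' _ h)
  else none

/-- The `(m+1)`-st point of the greedy selection in `S`: maximise `score`, remove from `S` the
set `excl x` around the selected point `x`, and repeat. It is `none` if `S` has been exhausted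
before. -/
def greedyPoint (score : Fin N → ℝ) (excl : Fin N → Finset (Fin N)) :
    ℕ → Finset (Fin N) → Option (Fin N)
  | 0, S => firstMax score S
  | m + 1, S =>
    match firstMax score S with
    | none => none
    | some x => greedyPoint score excl m (S \ excl x)

/-- `A_{n,j}(u)`, as a function of `score = f_{n+κ, j+σ+3}`. -/
def greedyValue (score : Fin N → ℝ) (n : ℕ) (j : ℤ) (u : Fin N) : ℝ :=
  match greedyPoint score (fun x => ballT4 κ U T (j + σ + 3) x (2 ^ (n + κ)))
      (bigN (n + κ) - 1) (ballT κ U T (j + 1) u (2 ^ n)) with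
  | none => 0
  | some x => 2 ^ n * ratio κ ^ (-j - σ - 1) + score x

/-- The functions `f_{n,j}`, for `j ≥ j_0(T) - σ - 2`: zero if `n > n(T) + κ` or
`j ≥ j(T) + σ + 3`, and otherwise the maximum of `f_{n+κ, j+1}`, `A_{n,j}` and `f_{n, j+1}`. -/
def fnj (n : ℕ) (j : ℤ) : Fin N → ℝ :=
  if n ≤ nTop N + κ ∧ j < jHigh κ U T + σ + 3 then
    fun u => max (fnj (n + κ) (j + 1) u)
      (max (greedyValue κ σ U T (fnj (n + κ) (j + σ + 3)) n j u) (fnj n (j + 1) u))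
  else 0
termination_by (jHigh κ U T + σ + 3 - j).toNat
decreasing_by all_goals omega

/-- The index range `0 ≤ n ≤ n(T) + κ`, `j_0(T) - σ - 2 ≤ j ≤ j(T) + σ + 3`. -/
def InWindow (n : ℕ) (j : ℤ) : Prop :=
  n ≤ nTop N + κ ∧ jLow κ U T - σ - 2 ≤ j ∧ j ≤ jHigh κ U T + σ + 3

end Functions

/-! ### Deterministic unit-cost programs

A program manipulates integer cells and real cells, each addressed by the name of an array and
three integer indices. The integer operations are addition, subtraction and comparison. The real
operations are addition, comparison and the formation of an integer power of two. The data of a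
problem instance are read through two integer-valued queries. -/

/-- The answers to the two kinds of queries, each with three integer arguments. -/
structure Oracle where
  level : ℤ → ℤ → ℤ → ℤ
  level4 : ℤ → ℤ → ℤ → ℤ

/-- The memory: the integer cells and the real cells. -/
structure State where
  ints : ℕ × ℤ × ℤ × ℤ → ℤ
  reals : ℕ × ℤ × ℤ × ℤ → ℝ

/-- Integer expressions. -/
inductive IExp where
  | const (c : ℤ)
  | get (name : ℕ) (i k l : IExp)
  | add (a b : IExp)
  | sub (a b : IExp)
  | level (n a b : IExp)
  | level4 (n a b : IExp)

/-- Real expressions. -/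
inductive RExp where
  | zero
  | get (name : ℕ) (i k l : IExp)
  | add (x y : RExp)
  | pow2 (e : IExp)

/-- Tests. -/
inductive Test where
  | ilt (a b : IExp)
  | rlt (x y : RExp)
  | neg (t : Test)
  | conj (t t' : Test)

/-- Programs. -/
inductive Cmd where
  | skip
  | setInt (name : ℕ) (i k l : IExp) (e : IExp)
  | setReal (name : ℕ) (i k l : IExp) (e : RExp)
  | seq (c c' : Cmd)
  | branch (t : Test) (c c' : Cmd)
  | loop (t : Test) (c : Cmd)

def IExp.eval (O : Oracle) (s : State) : IExp → ℤ
  | .const c => c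
  | .get name i k l => s.ints (name, i.eval O s, k.eval O s, l.eval O s)
  | .add a b => a.eval O s + b.eval O s
  | .sub a b => a.eval O s - b.eval O s
  | .level n a b => O.level (n.eval O s) (a.eval O s) (b.eval O s)
  | .level4 n a b => O.level4 (n.eval O s) (a.eval O s) (b.eval O s)

def RExp.eval (O : Oracle) (s : State) : RExp → ℝ
  | .zero => 0
  | .get name i k l => s.reals (name, i.eval O s, k.eval O s, l.eval O s)
  | .add x y => x.eval O s + y.eval O s
  | .pow2 e => (2 : ℝ) ^ (e.eval O s)

def Test.holds (O : Oracle) (s : State) : Test → Prop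
  | .ilt a b => a.eval O s < b.eval O s
  | .rlt x y => x.eval O s < y.eval O s
  | .neg t => ¬ t.holds O s
  | .conj t t' => t.holds O s ∧ t'.holds O s

/-- The number of operations in an integer expression. -/
def IExp.cost : IExp → ℕ
  | .const _ => 1
  | .get _ i k l => i.cost + k.cost + l.cost + 1
  | .add a b => a.cost + b.cost + 1
  | .sub a b => a.cost + b.cost + 1
  | .level n a b => n.cost + a.cost + b.cost + 1
  | .level4 n a b => n.cost + a.cost + b.cost + 1

/-- The number of operations in a real expression. -/
def RExp.cost : RExp → ℕ
  | .zero => 1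
  | .get _ i k l => i.cost + k.cost + l.cost + 1
  | .add x y => x.cost + y.cost + 1
  | .pow2 e => e.cost + 1

/-- The number of operations in a test. -/
def Test.cost : Test → ℕ
  | .ilt a b => a.cost + b.cost + 1
  | .rlt x y => x.cost + y.cost + 1
  | .neg t => t.cost + 1
  | .conj t t' => t.cost + t'.cost + 1

/-- `Exec O c s k s'`: started in the memory `s`, the program `c` halts after `k` steps with the
memory `s'`. -/
inductive Exec (O : Oracle) : Cmd → State → ℕ → State → Prop
  | skip (s : State) : Exec O .skip s 1 s
  | setInt (s : State) (name : ℕ) (i k l e : IExp) :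
      Exec O (.setInt name i k l e) s (i.cost + k.cost + l.cost + e.cost + 1)
        ⟨Function.update s.ints (name, i.eval O s, k.eval O s, l.eval O s) (e.eval O s), s.reals⟩
  | setReal (s : State) (name : ℕ) (i k l : IExp) (e : RExp) :
      Exec O (.setReal name i k l e) s (i.cost + k.cost + l.cost + e.cost + 1)
        ⟨s.ints, Function.update s.reals (name, i.eval O s, k.eval O s, l.eval O s) (e.eval O s)⟩
  | seq {c c' : Cmd} {s s' s'' : State} {m m' : ℕ} :
      Exec O c s m s' → Exec O c' s' m' s'' → Exec O (.seq c c') s (m + m') s''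
  | branchTrue {t : Test} {c c' : Cmd} {s s' : State} {m : ℕ} :
      t.holds O s → Exec O c s m s' → Exec O (.branch t c c') s (t.cost + m) s'
  | branchFalse {t : Test} {c c' : Cmd} {s s' : State} {m : ℕ} :
      ¬ t.holds O s → Exec O c' s m s' → Exec O (.branch t c c') s (t.cost + m) s'
  | loopTrue {t : Test} {c : Cmd} {s s' s'' : State} {m m' : ℕ} :
      t.holds O s → Exec O c s m s' → Exec O (.loop t c) s' m' s'' →
      Exec O (.loop t c) s (t.cost + m + m') s''
  | loopFalse {t : Test} {c : Cmd} {s : State} :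
      ¬ t.holds O s → Exec O (.loop t c) s t.cost s

/-- The initial memory: the integer cells with name `0` and indices `(k, 0, 0)` hold the entries
of the list of input integers, and all other cells hold zero. -/
def initState (input : List ℤ) : State where
  ints := fun p =>
    if p.1 = 0 ∧ 0 ≤ p.2.1 ∧ p.2.2 = (0, 0) then input.getD p.2.1.toNat 0 else 0
  reals := fun _ => 0

/-- On the given input, the program `c` halts after at most `b` steps with the number `v` in the
real cell with name `0` and indices `(0, 0, 0)`. -/
def ComputesWithin (O : Oracle) (c : Cmd) (input : List ℤ) (v : ℝ) (b : ℕ) : Prop :=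
  ∃ (k : ℕ) (s : State), k ≤ b ∧ Exec O c (initState input) k s ∧ s.reals (0, 0, 0, 0) = v

/-- The access to `T = {T 0, …, T (N-1)}`: for distinct indices `a`, `b` and for `n ≥ 0`, the two
queries return `j_n({T a, T b})` and `j_n({T a / 4, T b / 4})`. All other queries return `0`. -/
def oracleOf (κ : ℕ) (U : ℕ → ℝ → ℝ) {N : ℕ} (T : Fin N → Ell2) : Oracle where
  level n a b :=
    if h : 0 ≤ n ∧ (0 ≤ a ∧ a < N) ∧ (0 ≤ b ∧ b < N) ∧ a ≠ b then
      levelOf U (ratio κ) n.toNat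
        {T ⟨a.toNat, by omega⟩, T ⟨b.toNat, by omega⟩}
    else 0
  level4 n a b :=
    if h : 0 ≤ n ∧ (0 ≤ a ∧ a < N) ∧ (0 ≤ b ∧ b < N) ∧ a ≠ b then
      levelOf U (ratio κ) n.toNat
        {(1 / 4 : ℝ) • T ⟨a.toNat, by omega⟩, (1 / 4 : ℝ) • T ⟨b.toNat, by omega⟩}
    else 0

end LogConcaveProcess

end

open LogConcaveProcess

namespace LogConcaveProcess

/-! Although the window of scales `j` may be arbitrarily long, the rows `j ↦ f_{n,j}` change at only
polynomially many scales, and these can be located by queries.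

Geometry. Subadditivity of `𝒩_u` and the bound `𝒩_{lu} ≤ l 𝒩_u` for `l ≥ 1` show that a nonzero
`A_{n,j}(u)` forces two distinct points `x, y` with `j ≤ j_n({x,y}) ≤ j + σ + 2`: both lie in one
ball of scale `j + 1`, yet they are separated at scale `j + σ + 3` (`level_near_of_separated`). It
also forces `N_{n+κ} ≤ |T|`, because every greedy round removes at least the selected point. Hence
`A_{n,j}` vanishes outside the window, and the recursion holds for all `n` and `j` (`fnj_eq`). The
programs therefore never need `n(T)` or `j(T)`: they let `n` run up to `N + κ`.

Constancy. If `A` vanishes on a stretch of `N + κ + 1` consecutive scales starting at `j`, then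
`f_{n,j} = f_{n,j+1}` for all `n` (`shift_eq_of_source_eq_zero`, `fnj_succ_eq`). A row can thus
differ from the next one only within distance `N + κ + σ + 2` below some query answer. There are at
most `(N+κ+1) N² (N+κ+σ+3)` such scales, and above all answers every row is zero.

Algorithm. Starting above all answers, the sweep jumps from one such scale to the next lower one.
Before a row is computed, the last known row is copied into the few rows that the recursion reads.
Indexed memory makes the size of the jumps irrelevant to the cost. Since `f_{n,j}` decreases in `j`,
the suprema over the window are already attained in the lowest row `j_0 - σ - 2`, and `j_0` is the
minimum of the answers at `n = 0`.

Running time. A weakest-precondition calculus `wp` caps every loop at `X` iterations; this bounds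
the cost by a polynomial in `X`, and `X` is taken polynomial in `N` (`exec_of_wp`, `loopPoly`).

Memory layout. Integer names: 0 input, with `N` in its first cell; 1 target row; 2 last computed
row; 3 current row or running maximum; 4 and 5 capped powers of two; 6 the numbers `N_{n+κ}`; 7 `n`;
8 and 9 points; 10 greedy round; 11 `u`; 12 the remaining set; 13 the selected point; 14 and 15
counters. Real names: 0 output; 1 the values `f_{n,j}(u)`; 2 accumulator. -/

/-- The properties of the tail exponents that the estimates of the distances use. -/
structure IsTailFamily (U : ℕ → ℝ → ℝ) : Prop where
  convex : ∀ i, ConvexOn ℝ (Set.Ici 0) (U i)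
  zero : ∀ i, U i 0 = 0
  one : ∀ i, U i 1 = 1

theorem isTailFamily_of_tailExponent {Ω : Type*} [MeasurableSpace Ω] {P : Measure Ω}
    [IsProbabilityMeasure P] {Y : ℕ → Ω → ℝ} {U : ℕ → ℝ → ℝ}
    (hU : ∀ i, U i = tailExponent P (Y i)) (hconv : ∀ i, ConvexOn ℝ (Set.Ici 0) (U i))
    (h1 : ∀ i, U i 1 = 1) : IsTailFamily U := by
  refine ⟨hconv, fun i => ?_, h1⟩
  rw [hU i, tailExponent]
  simp

/-! ### Growth and scaling of the modified exponents -/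

section HatU

variable {f : ℝ → ℝ}

/-- The point `1` lies between `0` and `x`, so `f 1 = 1` is below the chord value `f x / x`. -/
theorem le_of_convexOn_Ici (hf : ConvexOn ℝ (Set.Ici 0) f) (h0 : f 0 = 0) (h1 : f 1 = 1) {x : ℝ}
    (hx : 1 ≤ x) : x ≤ f x := by
  have hx0 : 0 < x := by linarith
  have h := hf.2 (mem_Ici.2 le_rfl) (mem_Ici.2 hx0.le)
    (show 0 ≤ 1 - 1 / x by rw [sub_nonneg, div_le_one hx0]; exact hx)
    (show 0 ≤ 1 / x by positivity) (by ring)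
  simp only [smul_eq_mul, h0, mul_zero, zero_add] at h
  rw [one_div_mul_cancel hx0.ne', h1, one_div, inv_mul_eq_div, le_div_iff₀ hx0] at h
  linarith

theorem hatU_zero : hatU f 0 = 0 := by simp [hatU]

theorem hatU_neg (x : ℝ) : hatU f (-x) = hatU f x := by simp [hatU]

theorem abs_le_hatU (hf : ConvexOn ℝ (Set.Ici 0) f) (h0 : f 0 = 0) (h1 : f 1 = 1) {x : ℝ}
    (hx : 1 < |x|) : 2 * |x| - 1 ≤ hatU f x := by
  rw [hatU, if_neg (not_le.2 hx)]
  have := le_of_convexOn_Ici hf h0 h1 hx.le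
  linarith

theorem hatU_nonneg (hf : ConvexOn ℝ (Set.Ici 0) f) (h0 : f 0 = 0) (h1 : f 1 = 1) (x : ℝ) :
    0 ≤ hatU f x := by
  by_cases hx : |x| ≤ 1
  · rw [hatU, if_pos hx]; positivity
  · have := abs_le_hatU hf h0 h1 (not_le.1 hx)
    linarith [not_le.1 hx]

/-- On `[-1, 1]` the two functions coincide; outside, `|x| ≤ hatU f x ≤ u`. This is what places
admissible sequences in `ℓ²`. -/
theorem sq_le_max_mul_hatU (hf : ConvexOn ℝ (Set.Ici 0) f) (h0 : f 0 = 0) (h1 : f 1 = 1)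
    {x u : ℝ} (hu : hatU f x ≤ u) : x ^ 2 ≤ max 1 u * hatU f x := by
  by_cases hx : |x| ≤ 1
  · have h2 : hatU f x = x ^ 2 := by rw [hatU, if_pos hx]
    rw [h2]
    nlinarith [le_max_left 1 u, sq_nonneg x]
  · have h2 := abs_le_hatU hf h0 h1 (not_le.1 hx)
    have h3 := not_le.1 hx
    have h4 : |x| ≤ hatU f x := by linarith
    rw [← sq_abs]
    calc |x| ^ 2 = |x| * |x| := sq _
      _ ≤ max 1 u * hatU f x :=
        mul_le_mul (h4.trans (hu.trans (le_max_right _ _))) h4 (abs_nonneg x) (by positivity)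

/-- This is convexity along rays from the origin, where `hatU` vanishes. It is checked by hand in
three cases according to the positions of `|x|` and `|c * x|` relative to the junction at `1`. -/
theorem hatU_mul_le (hf : ConvexOn ℝ (Set.Ici 0) f) (h0 : f 0 = 0) (h1 : f 1 = 1) {c : ℝ}
    (hc0 : 0 ≤ c) (hc1 : c ≤ 1) (x : ℝ) : hatU f (c * x) ≤ c * hatU f x := by
  have habs : |c * x| = c * |x| := by rw [abs_mul, abs_of_nonneg hc0]
  by_cases hx : |x| ≤ 1
  · have hcx : |c * x| ≤ 1 := by rw [habs]; nlinarith [abs_nonneg x]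
    rw [hatU, hatU, if_pos hx, if_pos hcx]
    have : c * c ≤ c := by nlinarith
    nlinarith [sq_nonneg x]
  · have hx1 := not_le.1 hx
    by_cases hcx : |c * x| ≤ 1
    · have h2 := abs_le_hatU hf h0 h1 hx1
      rw [hatU, if_pos hcx, ← sq_abs, habs]
      rw [habs] at hcx
      have h3 : c * |x| ≤ c * hatU f x := mul_le_mul_of_nonneg_left (by linarith) hc0
      have h4 : (c * |x|) ^ 2 ≤ c * |x| := by
        have : 0 ≤ c * |x| := by positivity
        nlinarith
      linarith
    · rw [hatU, hatU, if_neg hx, if_neg hcx, habs]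
      rw [habs, not_le] at hcx
      set y := |x|
      have hy : 0 < y - 1 := by linarith
      have hU := le_of_convexOn_Ici hf h0 h1 hx1.le
      -- The weights express `c * y` as a convex combination of `1` and `y`; then `U(y) ≥ y`
      -- finishes the estimate.
      have hcv := hf.2 (mem_Ici.2 zero_le_one) (mem_Ici.2 (abs_nonneg x))
        (show 0 ≤ y * (1 - c) / (y - 1) from
          div_nonneg (mul_nonneg (by linarith) (by linarith)) hy.le)
        (show 0 ≤ (c * y - 1) / (y - 1) from div_nonneg (by linarith) hy.le) (by field_simp; ring)
      simp only [smul_eq_mul, h1, mul_one] at hcv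
      have he : y * (1 - c) / (y - 1) + (c * y - 1) / (y - 1) * y = c * y := by
        field_simp; ring
      rw [he] at hcv
      have hk : 0 ≤ (1 - c) / (y - 1) := div_nonneg (by linarith) hy.le
      have e1 : y * (1 - c) / (y - 1) = (1 - c) + (1 - c) / (y - 1) := by field_simp; ring
      have e2 : (c * y - 1) / (y - 1) = c - (1 - c) / (y - 1) := by field_simp; ring
      rw [e1, e2] at hcv
      have e3 : (1 - c) / (y - 1) * (y - 1) = 1 - c := by field_simp
      nlinarith [mul_le_mul_of_nonneg_left hU hk]

end HatU

/-! ### The functional `𝒩_u`, the distances `φ_j` and their levels -/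

section DualNorm

variable {U : ℕ → ℝ → ℝ} (hU : IsTailFamily U)
include hU

/-- Each single term is at most the whole sum, hence at most `u`, so the pointwise comparison of `a
i ^ 2` with `hatU` applies with one constant for all `i`. -/
theorem summable_sq_of_hatU {u : ℝ} {a : ℕ → ℝ} (ha : Summable fun i => hatU (U i) (a i))
    (hau : ∑' i, hatU (U i) (a i) ≤ u) :
    Summable (fun i => a i ^ 2) ∧ ∑' i, a i ^ 2 ≤ max 1 u * u := by
  have hle (i : ℕ) : a i ^ 2 ≤ max 1 u * hatU (U i) (a i) :=
    sq_le_max_mul_hatU (hU.convex i) (hU.zero i) (hU.one i)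
      ((ha.le_tsum i fun j _ => hatU_nonneg (hU.convex j) (hU.zero j) (hU.one j) _).trans hau)
  have hs := Summable.of_nonneg_of_le (fun i => sq_nonneg (a i)) hle (ha.mul_left _)
  refine ⟨hs, (hs.tsum_le_tsum hle (ha.mul_left _)).trans ?_⟩
  rw [tsum_mul_left]
  exact mul_le_mul_of_nonneg_left hau (by positivity)

omit hU in
theorem Ell2.summable_sq (t : Ell2) : Summable fun i => t i ^ 2 := by
  have := lp.memℓp t
  rw [memℓp_gen_iff (by norm_num)] at this
  simpa using this

theorem summable_mul_of_hatU {u : ℝ} {a : ℕ → ℝ} (t : Ell2)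
    (ha : Summable fun i => hatU (U i) (a i)) (hau : ∑' i, hatU (U i) (a i) ≤ u) :
    Summable (fun i => t i * a i) ∧ ∑' i, t i * a i ≤ ∑' i, t i ^ 2 + max 1 u * u := by
  obtain ⟨h1, h2⟩ := summable_sq_of_hatU hU ha hau
  have ht := Ell2.summable_sq t
  have hs : Summable fun i => t i * a i := by
    refine Summable.of_norm_bounded (ht.add h1) fun i => ?_
    rw [Real.norm_eq_abs, abs_le]
    constructor <;> nlinarith [sq_nonneg (t i + a i), sq_nonneg (t i - a i)]
  refine ⟨hs, ?_⟩
  calc ∑' i, t i * a i ≤ ∑' i, (t i ^ 2 + a i ^ 2) :=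
        hs.tsum_le_tsum (fun i => by nlinarith [sq_nonneg (t i - a i), sq_nonneg (t i + a i)])
          (ht.add h1)
    _ = ∑' i, t i ^ 2 + ∑' i, a i ^ 2 := ht.tsum_add h1
    _ ≤ _ := by linarith

/-- Without this bound the real `sSup` in `dualNorm` would take its default value `0`. -/
theorem bddAbove_dualValues (u : ℝ) (t : Ell2) : BddAbove (dualValues U u t) := by
  refine ⟨∑' i, t i ^ 2 + max 1 u * u, ?_⟩
  rintro _ ⟨a, ha, hau, rfl⟩
  exact (summable_mul_of_hatU hU t ha hau).2

omit hU in
theorem zero_mem_dualValues {u : ℝ} (hu : 0 ≤ u) (t : Ell2) : 0 ∈ dualValues U u t :=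
  ⟨0, by simp [hatU_zero, summable_zero], by simpa [hatU_zero] using hu, by simp⟩

theorem dualNorm_nonneg {u : ℝ} (hu : 0 ≤ u) (t : Ell2) : 0 ≤ dualNorm U u t :=
  le_csSup (bddAbove_dualValues hU u t) (zero_mem_dualValues hu t)

/-- Strict positivity makes the level of a pair of distinct points finite. -/
theorem dualNorm_pos {u : ℝ} (hu : 0 < u) {t : Ell2} (ht : t ≠ 0) : 0 < dualNorm U u t := by
  obtain ⟨i, hi⟩ : ∃ i, t i ≠ 0 := by
    by_contra! h
    exact ht (lp.ext (funext h))
  set c := min 1 u with hc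
  have hc0 : 0 < c := lt_min one_pos hu
  have hc1 : c ≤ 1 := min_le_left _ _
  -- A single coordinate suffices as test sequence. The size `c = min 1 u` keeps it in the quadratic
  -- range, with `c ^ 2 ≤ c ≤ u`.
  set a : ℕ → ℝ := Pi.single i (c * SignType.sign (t i)) with ha
  have hsign : |(SignType.sign (t i) : ℝ)| ≤ 1 := by
    rcases lt_trichotomy (t i) 0 with h | h | h <;> simp [h]
  have hz (k : ℕ) (hk : k ≠ i) : a k = 0 := by simp [ha, hk]
  have hai : a i = c * SignType.sign (t i) := by simp [ha]
  have habs : |a i| ≤ c := by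
    rw [hai, abs_mul, abs_of_pos hc0]
    exact mul_le_of_le_one_right hc0.le hsign
  have hhat : hatU (U i) (a i) ≤ u := by
    rw [hatU, if_pos (habs.trans hc1), ← sq_abs]
    have : c ≤ u := min_le_right _ _
    nlinarith [abs_nonneg (a i)]
  have hmem : |t i| * c ∈ dualValues U u t := by
    refine ⟨a, summable_of_ne_finset_zero (s := {i}) fun k hk => ?_, ?_, ?_⟩
    · rw [hz k (by simpa using hk), hatU_zero]
    · rwa [tsum_eq_single i fun k hk => by rw [hz k hk, hatU_zero]]
    · rw [tsum_eq_single i fun k hk => by rw [hz k hk, mul_zero], hai]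
      rw [mul_left_comm, self_mul_sign, mul_comm]
  exact (mul_pos (abs_pos.2 hi) hc0).trans_le (le_csSup (bddAbove_dualValues hU u t) hmem)

theorem dualNorm_mono {u v : ℝ} (hu : 0 ≤ u) (huv : u ≤ v) (t : Ell2) :
    dualNorm U u t ≤ dualNorm U v t := by
  refine csSup_le_csSup (bddAbove_dualValues hU v t) ⟨0, zero_mem_dualValues hu t⟩ ?_
  rintro _ ⟨a, ha, hau, rfl⟩
  exact ⟨a, ha, hau.trans huv, rfl⟩

/-- Dividing an admissible sequence for `l * u` by `l` makes it admissible for `u`. Equivalently,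
`𝒩_u / u` is nonincreasing in `u`. -/
theorem dualNorm_le_mul {u l : ℝ} (hu : 0 ≤ u) (hl : 1 ≤ l) (t : Ell2) :
    dualNorm U (l * u) t ≤ l * dualNorm U u t := by
  have hl0 : 0 < l := by linarith
  refine csSup_le ⟨0, zero_mem_dualValues (by positivity) t⟩ ?_
  rintro _ ⟨a, ha, hau, rfl⟩
  have hle (i : ℕ) : hatU (U i) (l⁻¹ * a i) ≤ l⁻¹ * hatU (U i) (a i) :=
    hatU_mul_le (hU.convex i) (hU.zero i) (hU.one i) (by positivity) (inv_le_one_of_one_le₀ hl) _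
  have hs : Summable fun i => hatU (U i) (l⁻¹ * a i) :=
    Summable.of_nonneg_of_le
      (fun i => hatU_nonneg (hU.convex i) (hU.zero i) (hU.one i) _) hle (ha.mul_left _)
  have hmem : l⁻¹ * ∑' i, t i * a i ∈ dualValues U u t := by
    refine ⟨fun i => l⁻¹ * a i, hs, (hs.tsum_le_tsum hle (ha.mul_left _)).trans ?_, ?_⟩
    · rw [tsum_mul_left, inv_mul_le_iff₀ hl0]
      exact hau
    · rw [← tsum_mul_left]
      exact tsum_congr fun i => by ring
  have := le_csSup (bddAbove_dualValues hU u t) hmem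
  rwa [inv_mul_le_iff₀ hl0] at this

theorem dualNorm_add_le {u : ℝ} (hu : 0 ≤ u) (s t : Ell2) :
    dualNorm U u (s + t) ≤ dualNorm U u s + dualNorm U u t := by
  refine csSup_le ⟨0, zero_mem_dualValues hu _⟩ ?_
  rintro _ ⟨a, ha, hau, rfl⟩
  have e : ∑' i, (s + t) i * a i = ∑' i, s i * a i + ∑' i, t i * a i := by
    rw [← (summable_mul_of_hatU hU s ha hau).1.tsum_add (summable_mul_of_hatU hU t ha hau).1]
    exact tsum_congr fun i => by simp [add_mul]
  rw [e]
  exact add_le_add (le_csSup (bddAbove_dualValues hU u s) ⟨a, ha, hau, rfl⟩)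
    (le_csSup (bddAbove_dualValues hU u t) ⟨a, ha, hau, rfl⟩)

omit hU in
theorem dualNorm_neg (u : ℝ) (t : Ell2) : dualNorm U u (-t) = dualNorm U u t := by
  have h (t : Ell2) : dualValues U u t ⊆ dualValues U u (-t) := by
    rintro _ ⟨a, ha, hau, rfl⟩
    exact ⟨-a, by simpa [hatU_neg] using ha, by simpa [hatU_neg] using hau, by simp⟩
  have h2 : dualValues U u (-t) ⊆ dualValues U u t := by simpa using h (-t)
  exact congrArg sSup (Set.Subset.antisymm h2 (h t))

omit hU in
theorem dualNorm_smul (u : ℝ) {c : ℝ} (hc : 0 < c) (t : Ell2) :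
    dualNorm U u (c • t) = c * dualNorm U u t := by
  have : dualValues U u (c • t) = c • dualValues U u t := by
    ext v
    simp only [mem_smul_set, dualValues, mem_ofPred_eq, smul_eq_mul]
    constructor
    · rintro ⟨a, ha, hau, rfl⟩
      refine ⟨_, ⟨a, ha, hau, rfl⟩, ?_⟩
      rw [← tsum_mul_left]
      exact tsum_congr fun i => by simp [mul_assoc]
    · rintro ⟨_, ⟨a, ha, hau, rfl⟩, rfl⟩
      refine ⟨a, ha, hau, ?_⟩
      rw [← tsum_mul_left]
      exact tsum_congr fun i => by simp [mul_assoc]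
  rw [dualNorm, this, Real.sSup_smul_of_nonneg hc.le, smul_eq_mul, dualNorm]

/-- Since `𝒩_u / u` is nonincreasing, the admissible `u` form an upward closed set. Monotonicity of
`𝒩_u` in `u` shows that its infimum is attained when positive, so testing `u = c` is enough. -/
theorem phi_le_iff {r : ℝ} (hr : 0 < r) (j : ℤ) (s t : Ell2) {c : ℝ} (hc : 0 < c) :
    phi U r j s t ≤ ENNReal.ofReal c ↔ r ^ j * dualNorm U c (s - t) ≤ c := by
  have hmem (u : ℝ) : s - t ∈ (r ^ (-j)) • dualBall U u ↔ r ^ j * dualNorm U u (s - t) ≤ u := by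
    rw [mem_smul_set_iff_inv_smul_mem₀ (zpow_ne_zero _ hr.ne'), dualBall, mem_ofPred_eq,
      zpow_neg, inv_inv, dualNorm_smul u (zpow_pos hr j)]
  have hrj : 0 < r ^ j := zpow_pos hr j
  constructor
  · intro h
    refine le_of_forall_gt_imp_ge_of_dense fun v hv => ?_
    have hlt : phi U r j s t < ENNReal.ofReal v :=
      h.trans_lt ((ENNReal.ofReal_lt_ofReal_iff (hc.trans hv)).2 hv)
    simp only [phi, iInf_lt_iff] at hlt
    obtain ⟨u, hu, hin, huv⟩ := hlt
    rw [ENNReal.ofReal_lt_ofReal_iff (hc.trans hv)] at huv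
    rw [hmem] at hin
    rcases le_total u c with huc | hcu
    · have h1 : dualNorm U c (s - t) ≤ c / u * dualNorm U u (s - t) := by
        have := dualNorm_le_mul hU hu.le ((one_le_div hu).2 huc) (s - t)
        rwa [div_mul_cancel₀ _ hu.ne'] at this
      calc r ^ j * dualNorm U c (s - t) ≤ r ^ j * (c / u * dualNorm U u (s - t)) := by gcongr
        _ = c / u * (r ^ j * dualNorm U u (s - t)) := by ring
        _ ≤ c / u * u := by gcongr
        _ = c := div_mul_cancel₀ _ hu.ne'
        _ ≤ v := hv.le
    · calc r ^ j * dualNorm U c (s - t) ≤ r ^ j * dualNorm U u (s - t) := by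
            gcongr; exact dualNorm_mono hU hc.le hcu _
        _ ≤ v := hin.trans huv.le
  · intro h
    exact iInf_le_of_le c (iInf_le_of_le hc (iInf_le_of_le ((hmem c).2 h) le_rfl))

theorem phi_le_two_pow_iff {r : ℝ} (hr : 0 < r) (j : ℤ) (s t : Ell2) (n : ℕ) :
    phi U r j s t ≤ 2 ^ n ↔ r ^ j * dualNorm U (2 ^ n) (s - t) ≤ 2 ^ n := by
  rw [← phi_le_iff hU hr j s t (by positivity)]
  simp [ENNReal.ofReal_pow]

theorem phi_self_le {r : ℝ} (hr : 0 < r) (j : ℤ) (s : Ell2) (n : ℕ) :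
    phi U r j s s ≤ 2 ^ n := by
  rw [phi_le_two_pow_iff hU hr, sub_self]
  have : dualNorm U (2 ^ n) 0 = 0 := by
    have := dualNorm_smul (U := U) (2 ^ n) (c := 2) (by norm_num) 0
    rw [smul_zero] at this
    linarith
  rw [this, mul_zero]
  positivity

theorem phi_le_comm {r : ℝ} (hr : 0 < r) (j : ℤ) (s t : Ell2) (n : ℕ) :
    phi U r j s t ≤ 2 ^ n ↔ phi U r j t s ≤ 2 ^ n := by
  rw [phi_le_two_pow_iff hU hr, phi_le_two_pow_iff hU hr, ← dualNorm_neg, neg_sub]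

/-- The condition reads `r^j ≤ 2^n / 𝒩_{2^n}(s - t)`, which holds exactly for the integers up to
some `l`. The integer `sSup` is therefore a true maximum, and one query decides membership in a
ball. -/
theorem le_levelOf_pair_iff {r : ℝ} (hr : 1 < r) (j : ℤ) {s t : Ell2} (hst : s ≠ t) (n : ℕ) :
    j ≤ levelOf U r n {s, t} ↔ phi U r j s t ≤ 2 ^ n := by
  have hr0 : 0 < r := by linarith
  have hD : 0 < dualNorm U (2 ^ n) (s - t) := dualNorm_pos hU (by positivity) (sub_ne_zero.2 hst)
  obtain ⟨l, hl1, hl2⟩ := exists_mem_Ico_zpow (x := 2 ^ n / dualNorm U (2 ^ n) (s - t))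
    (by positivity) hr
  have hiff (j : ℤ) : phi U r j s t ≤ 2 ^ n ↔ j ≤ l := by
    rw [phi_le_two_pow_iff hU hr0, ← le_div_iff₀ hD]
    constructor
    · intro h
      exact Int.lt_add_one_iff.1 ((zpow_lt_zpow_iff_right₀ hr).1 (h.trans_lt hl2))
    · intro h
      exact (zpow_le_zpow_right₀ hr.le h).trans hl1
  have hset : {j : ℤ | ∀ x ∈ ({s, t} : Set Ell2), ∀ y ∈ ({s, t} : Set Ell2),
      phi U r j x y ≤ 2 ^ n} = Set.Iic l := by
    ext j
    simp only [mem_ofPred_eq, mem_insert_iff, mem_singleton_iff, forall_eq_or_imp, forall_eq,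
      mem_Iic, phi_self_le hU hr0, true_and, and_true, phi_le_comm hU hr0 j t s, and_self, hiff]
  rw [levelOf, hset, csSup_Iic, hiff]

theorem le_levelOf_iff {r : ℝ} (hr : 1 < r) (j : ℤ) {s t : Ell2} (hst : s ≠ t) (n : ℕ) :
    j ≤ levelOf U r n {s, t} ↔ r ^ j * dualNorm U (2 ^ n) (s - t) ≤ 2 ^ n := by
  rw [le_levelOf_pair_iff hU hr j hst, phi_le_two_pow_iff hU (by linarith)]

/-- Two distinct points that lie in a common ball and are separated at a finer scale pin down
the scale up to a bounded error. -/
theorem level_near_of_separated {r : ℝ} (hr : 4 ≤ r) {j : ℤ} {u x y : Ell2} {n κ : ℕ} {σ : ℕ}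
    (hxy : x ≠ y)
    (hx : phi U r (j + 1) u x ≤ 2 ^ n) (hy : phi U r (j + 1) u y ≤ 2 ^ n)
    (hsep : ¬ phi U r (j + σ + 3) ((1 / 4 : ℝ) • x) ((1 / 4 : ℝ) • y) ≤ 2 ^ (n + κ)) :
    j ≤ levelOf U r n {x, y} ∧ levelOf U r n {x, y} ≤ j + σ + 2 := by
  have hr0 : 0 < r := by linarith
  have hr1 : 1 < r := by linarith
  rw [phi_le_two_pow_iff hU hr0] at hx hy hsep
  rw [← smul_sub, dualNorm_smul _ (by norm_num)] at hsep
  have htri : dualNorm U (2 ^ n) (x - y)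
      ≤ dualNorm U (2 ^ n) (u - x) + dualNorm U (2 ^ n) (u - y) := by
    have := dualNorm_add_le hU (u := 2 ^ n) (by positivity) (-(u - x)) (u - y)
    rwa [dualNorm_neg, show -(u - x) + (u - y) = x - y by abel] at this
  have hmul : dualNorm U (2 ^ (n + κ)) (x - y) ≤ 2 ^ κ * dualNorm U (2 ^ n) (x - y) := by
    rw [pow_add, mul_comm]
    exact dualNorm_le_mul hU (by positivity) (one_le_pow₀ (by norm_num)) _
  have hD := dualNorm_nonneg hU (u := 2 ^ n) (by positivity) (x - y)
  have hrj : 0 < r ^ j := zpow_pos hr0 j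
  constructor
  · rw [le_levelOf_iff hU hr1 _ hxy]
    rw [zpow_add_one₀ hr0.ne'] at hx hy
    -- The triangle inequality through `u` costs a factor `2`, which passing from scale `j + 1` to
    -- `j` absorbs because `r ≥ 4`.
    have h1 : r ^ j * r * dualNorm U (2 ^ n) (x - y) ≤ 2 * 2 ^ n :=
      (mul_le_mul_of_nonneg_left htri (by positivity)).trans (by rw [mul_add]; linarith)
    have h2 : 0 ≤ r ^ j * dualNorm U (2 ^ n) (x - y) := by positivity
    nlinarith
  · by_contra! hlt
    have h1 : j + σ + 3 ≤ levelOf U r n {x, y} := by omega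
    -- A level of at least `j + σ + 3` would contradict the separation: replacing `2^n` by `2^(n+κ)`
    -- raises the functional by at most `2^κ`, the same factor as the radius.
    rw [le_levelOf_iff hU hr1 _ hxy] at h1
    apply hsep
    have hrk : 0 < r ^ (j + σ + 3) := zpow_pos hr0 _
    calc r ^ (j + σ + 3) * (1 / 4 * dualNorm U (2 ^ (n + κ)) (x - y))
        ≤ r ^ (j + σ + 3) * (1 / 4 * (2 ^ κ * dualNorm U (2 ^ n) (x - y))) := by gcongr
      _ = 1 / 4 * (2 ^ κ * (r ^ (j + σ + 3) * dualNorm U (2 ^ n) (x - y))) := by ring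
      _ ≤ 1 / 4 * (2 ^ κ * 2 ^ n) := by gcongr
      _ ≤ 2 ^ (n + κ) := by rw [pow_add]; nlinarith [show (0 : ℝ) < 2 ^ κ * 2 ^ n by positivity]

end DualNorm

/-! ### The greedy selection -/

section Greedy

variable {N : ℕ} {score : Fin N → ℝ} {excl : Fin N → Finset (Fin N)} {S : Finset (Fin N)}

theorem mem_of_firstMax_eq_some {x : Fin N} (h : firstMax score S = some x) : x ∈ S := by
  unfold firstMax at h
  split_ifs at h with hne
  rw [Option.some.injEq] at h
  exact h ▸ (Finset.mem_filter.1 (Finset.min'_mem _ hne)).1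

theorem firstMax_eq_none_iff : firstMax score S = none ↔ S = ∅ := by
  unfold firstMax
  constructor
  · intro h
    split_ifs at h with hne
    by_contra hS
    obtain ⟨x, hx, hmax⟩ := S.exists_max_image score (Finset.nonempty_iff_ne_empty.2 hS)
    exact hne ⟨x, Finset.mem_filter.2 ⟨hx, hmax⟩⟩
  · rintro rfl
    simp

theorem firstMax_eq_some_iff {x : Fin N} : firstMax score S = some x ↔
    x ∈ S ∧ (∀ y ∈ S, score y ≤ score x) ∧ ∀ y ∈ S, y < x → score y < score x := by
  classical
  constructor
  · intro h
    have hx := mem_of_firstMax_eq_some h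
    unfold firstMax at h
    split_ifs at h with hne
    rw [Option.some.injEq] at h
    have hm := (Finset.mem_filter.1 (Finset.min'_mem _ hne)).2
    rw [h] at hm
    refine ⟨hx, hm, fun y hy hyx => ?_⟩
    by_contra! hle
    have : x ≤ y := h ▸ Finset.min'_le _ y
      (Finset.mem_filter.2 ⟨hy, fun z hz => (hm z hz).trans hle⟩)
    exact absurd hyx (not_lt.2 this)
  · rintro ⟨hx, hmax, hlt⟩
    have hmem : x ∈ ({x ∈ S | ∀ y ∈ S, score y ≤ score x} : Finset (Fin N)) :=
      Finset.mem_filter.2 ⟨hx, hmax⟩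
    have hne : ({x ∈ S | ∀ y ∈ S, score y ≤ score x} : Finset (Fin N)).Nonempty := ⟨x, hmem⟩
    unfold firstMax
    rw [dif_pos (by convert hne), Option.some.injEq]
    refine le_antisymm (Finset.min'_le _ _ (by convert hmem)) ?_
    refine Finset.le_min' _ _ _ fun y hy => ?_
    obtain ⟨hyS, hymax⟩ := Finset.mem_filter.1 hy
    by_contra! hyx
    exact absurd (hymax x hx) (not_le.2 (hlt y hyS hyx))

/-- One round of the greedy selection: the set that is left after the removal of `excl x` for the
selected point `x`. -/
noncomputable def greedyStep (score : Fin N → ℝ) (excl : Fin N → Finset (Fin N))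
    (S : Finset (Fin N)) : Finset (Fin N) :=
  match firstMax score S with
  | none => S
  | some x => S \ excl x

theorem greedyStep_empty : greedyStep score excl ∅ = ∅ := by
  simp [greedyStep, firstMax_eq_none_iff.2]

theorem greedyStep_iterate_empty (m : ℕ) : (greedyStep score excl)^[m] ∅ = ∅ :=
  Function.iterate_fixed greedyStep_empty m

/-- The recursion that stops on exhaustion becomes an iteration of a total map with fixed point `∅`.
In this form each round can be matched with one pass of a program loop. -/
theorem greedyPoint_eq (m : ℕ) (S : Finset (Fin N)) :
    greedyPoint score excl m S = firstMax score ((greedyStep score excl)^[m] S) := by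
  induction m generalizing S with
  | zero => rfl
  | succ m ih =>
    rw [greedyPoint, Function.iterate_succ_apply]
    cases h : firstMax score S with
    | none =>
      rw [firstMax_eq_none_iff] at h
      subst h
      rw [greedyStep_empty, greedyStep_iterate_empty]
      exact (firstMax_eq_none_iff.2 rfl).symm
    | some x => simp only [ih, greedyStep, h]

theorem greedyStep_subset : greedyStep score excl S ⊆ S := by
  unfold greedyStep
  split
  · exact Finset.Subset.refl _
  · exact Finset.sdiff_subset

/-- Every round on a nonempty set removes at least the selected point, as it belongs to its own
excluded set. -/
theorem card_greedyStep_iterate (hex : ∀ x, x ∈ excl x) {m : ℕ}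
    (h : ((greedyStep score excl)^[m] S).Nonempty) :
    m + ((greedyStep score excl)^[m] S).card ≤ S.card := by
  induction m with
  | zero => simp
  | succ m ih =>
    rw [Function.iterate_succ_apply'] at h ⊢
    have hne := h.mono greedyStep_subset
    have hlt : (greedyStep score excl ((greedyStep score excl)^[m] S)).card
        < ((greedyStep score excl)^[m] S).card := by
      refine Finset.card_lt_card ?_
      generalize (greedyStep score excl)^[m] S = R at hne
      unfold greedyStep
      cases hR : firstMax score R with
      | none => exact absurd (firstMax_eq_none_iff.1 hR) hne.ne_empty
      | some x =>
        refine ⟨Finset.sdiff_subset, fun hsub => ?_⟩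
        exact (Finset.mem_sdiff.1 (hsub (mem_of_firstMax_eq_some hR))).2 (hex x)
    have := ih hne
    omega

/-- The first selected point and the last one serve: the last has survived the removal around the
first. -/
theorem exists_separated_of_greedyPoint {m : ℕ} {z : Fin N}
    (h : greedyPoint score excl (m + 1) S = some z) :
    ∃ x ∈ S, ∃ y ∈ S, y ∉ excl x := by
  rw [greedyPoint_eq, Function.iterate_succ_apply] at h
  have hz := mem_of_firstMax_eq_some h
  have hsub : ∀ (k : ℕ) (R : Finset (Fin N)), (greedyStep score excl)^[k] R ⊆ R := by
    intro k
    induction k with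
    | zero => exact fun R => Finset.Subset.refl _
    | succ k ih => exact fun R => (ih _).trans greedyStep_subset
  have hz2 := hsub _ _ hz
  unfold greedyStep at hz2
  cases hS : firstMax score S with
  | none =>
    rw [firstMax_eq_none_iff] at hS
    subst hS
    rw [greedyStep_empty, greedyStep_iterate_empty] at hz
    simp at hz
  | some x =>
    simp only [hS] at hz2
    exact ⟨x, mem_of_firstMax_eq_some hS, z, (Finset.mem_sdiff.1 hz2).1,
      (Finset.mem_sdiff.1 hz2).2⟩

end Greedy

/-! ### The numbers `N_n` -/

theorem bigN_strictMono : StrictMono bigN := by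
  refine strictMono_nat_of_lt_succ fun n => ?_
  rcases n with _ | n
  · simp [bigN]
  · simp only [bigN, Nat.add_eq_zero_iff, one_ne_zero, and_false, if_false]
    exact Nat.pow_lt_pow_right (by norm_num) (Nat.pow_lt_pow_right (by norm_num) (by omega))

theorem le_bigN_nTop (N : ℕ) : N ≤ bigN (nTop N) :=
  Nat.sInf_mem (s := {n : ℕ | N ≤ bigN n}) ⟨N, bigN_strictMono.le_apply⟩

theorem nTop_le (N : ℕ) : nTop N ≤ N :=
  Nat.sInf_le (show N ≤ bigN N from bigN_strictMono.le_apply)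

theorem four_le_ratio {κ : ℕ} (hκ : 5 ≤ κ) : 4 ≤ ratio κ := by
  unfold ratio
  calc (4 : ℝ) = 2 ^ 2 := by norm_num
    _ ≤ 2 ^ (κ - 3) := pow_le_pow_right₀ (by norm_num) (by omega)

/-! ### Recursions whose source term vanishes -/

/-- Induction on the number `d` of steps by which `n` may have to be raised to pass `n₀`, where `f`
vanishes. Each raise of `n` by `κ` uses up one scale of the stretch on which the source is zero. -/
theorem shift_eq_of_source_eq_zero {ι : Type*} {κ n₀ : ℕ} (hκ : 0 < κ) {f A : ℕ → ℤ → ι → ℝ}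
    (hf : ∀ n j u, f n j u = max (f (n + κ) (j + 1) u) (max (A n j u) (f n (j + 1) u)))
    (hnonneg : ∀ n j u, 0 ≤ f n j u) (hzero : ∀ n j u, n₀ < n → f n j u = 0) {j₁ j₂ : ℤ}
    (hA : ∀ n j u, j₁ ≤ j → j < j₂ → A n j u = 0) (d : ℕ) :
    ∀ n j u, n₀ < n + d → j₁ ≤ j → j + d ≤ j₂ → f n j u = f n (j + 1) u := by
  induction d with
  | zero =>
    intro n j u h1 _ _
    rw [hzero n j u h1, hzero n (j + 1) u h1]
  | succ d ih =>
    intro n j u h1 h2 h3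
    push_cast at h3
    have e := ih (n + κ) (j + 1) u (by omega) (by omega) (by omega)
    -- The term `f (n + κ) (j + 1)` equals its successor in `j` by induction, and that successor
    -- already enters the maximum defining `f n (j + 1)`.
    have hle : f (n + κ) (j + 1 + 1) u ≤ f n (j + 1) u := by
      rw [hf n (j + 1) u]
      exact le_max_left _ _
    rw [hf n j u, hA n j u h2 (by omega), max_eq_right (hnonneg n (j + 1) u), e, max_eq_right hle]

/-! ### The distances in terms of the queries -/

section Queries

/-- The ball around `a` in the sense of the answers `g` to the queries. -/
def queryBall {N : ℕ} (g : ℤ → ℤ → ℤ → ℤ) (n : ℕ) (j : ℤ) (a : Fin N) : Finset (Fin N) :=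
  Finset.univ.filter fun b => a = b ∨ j ≤ g n (a : ℕ) (b : ℕ)

theorem mem_queryBall {N : ℕ} {g : ℤ → ℤ → ℤ → ℤ} {n : ℕ} {j : ℤ} {a b : Fin N} :
    b ∈ queryBall g n j a ↔ a = b ∨ j ≤ g n (a : ℕ) (b : ℕ) := by
  simp [queryBall]

variable {κ σ : ℕ} {U : ℕ → ℝ → ℝ} {N : ℕ} {T : Fin N → Ell2}

theorem oracle_level {a b : Fin N} (hab : a ≠ b) (n : ℕ) :
    (oracleOf κ U T).level n (a : ℕ) (b : ℕ) = levelOf U (ratio κ) n {T a, T b} := by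
  have hab' : (a : ℕ) ≠ b := fun h => hab (Fin.ext h)
  simp only [oracleOf]
  rw [dif_pos (by have := a.2; have := b.2; omega)]
  simp

theorem oracle_level4 {a b : Fin N} (hab : a ≠ b) (n : ℕ) :
    (oracleOf κ U T).level4 n (a : ℕ) (b : ℕ) =
      levelOf U (ratio κ) n {(1 / 4 : ℝ) • T a, (1 / 4 : ℝ) • T b} := by
  have hab' : (a : ℕ) ≠ b := fun h => hab (Fin.ext h)
  simp only [oracleOf]
  rw [dif_pos (by have := a.2; have := b.2; omega)]
  simp

variable (hU : IsTailFamily U) (hT : Function.Injective T) (hκ : 5 ≤ κ)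
include hU hT hκ

theorem phi_le_iff_level {a b : Fin N} (hab : a ≠ b) (n : ℕ) (j : ℤ) :
    phi U (ratio κ) j (T a) (T b) ≤ 2 ^ n ↔ j ≤ (oracleOf κ U T).level n (a : ℕ) (b : ℕ) := by
  rw [oracle_level hab,
    le_levelOf_pair_iff hU (by linarith [four_le_ratio hκ]) j (hT.ne hab)]

theorem mem_ballT_iff {a b : Fin N} {n : ℕ} {j : ℤ} :
    b ∈ ballT κ U T j a (2 ^ n) ↔ a = b ∨ j ≤ (oracleOf κ U T).level n (a : ℕ) (b : ℕ) := by
  simp only [ballT, Finset.mem_filter, Finset.mem_univ, true_and]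
  by_cases hab : a = b
  · subst hab
    simp [phi_self_le hU (by linarith [four_le_ratio hκ])]
  · rw [phi_le_iff_level hU hT hκ hab]
    simp [hab]

theorem mem_ballT4_iff {a b : Fin N} {n : ℕ} {j : ℤ} :
    b ∈ ballT4 κ U T j a (2 ^ n) ↔ a = b ∨ j ≤ (oracleOf κ U T).level4 n (a : ℕ) (b : ℕ) := by
  have hr : 1 < ratio κ := by linarith [four_le_ratio hκ]
  simp only [ballT4, Finset.mem_filter, Finset.mem_univ, true_and]
  by_cases hab : a = b
  · subst hab
    simp [phi_self_le hU (by linarith)]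
  · have hne : (1 / 4 : ℝ) • T a ≠ (1 / 4 : ℝ) • T b := fun h =>
      hT.ne hab (smul_right_injective _ (by norm_num) h)
    rw [oracle_level4 hab, le_levelOf_pair_iff hU hr j hne]
    simp [hab]

theorem level_mono {a b : Fin N} (hab : a ≠ b) {m n : ℕ} (hmn : m ≤ n) :
    (oracleOf κ U T).level m (a : ℕ) (b : ℕ) ≤ (oracleOf κ U T).level n (a : ℕ) (b : ℕ) := by
  rw [← phi_le_iff_level hU hT hκ hab]
  refine ((phi_le_iff_level hU hT hκ hab m _).2 le_rfl).trans ?_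
  exact pow_le_pow_right₀ (by norm_num) hmn

/-- There are finitely many pairs and at least one, so `j_0(T)` is the minimum of the answers at `n
= 0` over distinct points. -/
theorem le_jLow_iff (hN : 2 ≤ N) (j : ℤ) :
    j ≤ jLow κ U T ↔ ∀ a b : Fin N, a ≠ b → j ≤ (oracleOf κ U T).level 0 (a : ℕ) (b : ℕ) := by
  have hset : {j : ℤ | ∀ x ∈ Set.range T, ∀ y ∈ Set.range T, phi U (ratio κ) j x y ≤ 2 ^ 0} =
      {j : ℤ | ∀ a b : Fin N, a ≠ b → j ≤ (oracleOf κ U T).level 0 (a : ℕ) (b : ℕ)} := by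
    ext j
    simp only [mem_ofPred_eq, Set.forall_mem_range]
    refine forall_congr' fun a => forall_congr' fun b => ?_
    by_cases hab : a = b
    · subst hab
      simpa using phi_self_le hU (by linarith [four_le_ratio hκ]) j (T a) 0
    · rw [phi_le_iff_level hU hT hκ hab]
      simp [hab]
  let P : Finset (Fin N × Fin N) := Finset.univ.filter fun p => p.1 ≠ p.2
  have hP : P.Nonempty := ⟨(⟨0, by omega⟩, ⟨1, by omega⟩), by simp [P]⟩
  obtain ⟨p, hp, hmin⟩ := P.exists_min_image
    (fun p => (oracleOf κ U T).level 0 (p.1 : ℕ) (p.2 : ℕ)) hP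
  have hiff (j : ℤ) : (∀ a b : Fin N, a ≠ b → j ≤ (oracleOf κ U T).level 0 (a : ℕ) (b : ℕ)) ↔
      j ≤ (oracleOf κ U T).level 0 (p.1 : ℕ) (p.2 : ℕ) := by
    refine ⟨fun h => h _ _ (by simpa [P] using hp), fun h a b hab => h.trans ?_⟩
    exact hmin (a, b) (by simpa [P] using hab)
  have h2 : {j : ℤ | ∀ a b : Fin N, a ≠ b → j ≤ (oracleOf κ U T).level 0 (a : ℕ) (b : ℕ)} =
      Set.Iic ((oracleOf κ U T).level 0 (p.1 : ℕ) (p.2 : ℕ)) := Set.ext hiff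
  rw [jLow, levelOf, hset, h2, csSup_Iic, hiff]

/-- The set defining `j(T)` is nonempty and bounded below, so its infimum belongs to it. -/
theorem level_nTop_lt_jHigh (hN : 2 ≤ N) {a b : Fin N} (hab : a ≠ b) :
    (oracleOf κ U T).level (nTop N) (a : ℕ) (b : ℕ) < jHigh κ U T := by
  have hset : {j : ℤ | ∀ a b : Fin N, T a ≠ T b →
      2 ^ nTop N < phi U (ratio κ) j (T a) (T b)} =
      {j : ℤ | ∀ a b : Fin N, a ≠ b →
        (oracleOf κ U T).level (nTop N) (a : ℕ) (b : ℕ) < j} := by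
    ext j
    refine forall_congr' fun a => forall_congr' fun b => ?_
    rw [hT.ne_iff]
    refine imp_congr_right fun hab => ?_
    rw [← not_le, phi_le_iff_level hU hT hκ hab, not_le]
  obtain ⟨B, hB⟩ := (Set.finite_range fun p : Fin N × Fin N =>
    (oracleOf κ U T).level (nTop N) (p.1 : ℕ) (p.2 : ℕ)).bddAbove
  have hmem : jHigh κ U T ∈ {j : ℤ | ∀ a b : Fin N, a ≠ b →
      (oracleOf κ U T).level (nTop N) (a : ℕ) (b : ℕ) < j} := by
    rw [jHigh, hset]
    refine Int.csInf_mem ⟨B + 1, fun a b _ => Int.lt_add_one_iff.2 (hB ⟨(a, b), rfl⟩)⟩ ?_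
    refine ⟨(oracleOf κ U T).level (nTop N) ((⟨0, by omega⟩ : Fin N) : ℕ)
      ((⟨1, by omega⟩ : Fin N) : ℕ), fun j hj => (hj _ _ ?_).le⟩
    simp
  exact hmem a b hab

theorem jLow_lt_jHigh (hN : 2 ≤ N) : jLow κ U T < jHigh κ U T := by
  have hab : (⟨0, by omega⟩ : Fin N) ≠ ⟨1, by omega⟩ := by simp
  exact (((le_jLow_iff hU hT hκ hN _).1 le_rfl _ _ hab).trans
    (level_mono hU hT hκ hab (Nat.zero_le _))).trans_lt (level_nTop_lt_jHigh hU hT hκ hN hab)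

/-- The last round being reached bounds `N_{n+κ}` by the number of points, hence `n`; the first
round and the last one supply the separated pair, which pins `j` to a level. -/
theorem greedyPoint_isSome_imp {score : Fin N → ℝ} {n : ℕ} {j : ℤ} {u z : Fin N}
    (h : greedyPoint score (fun x => ballT4 κ U T (j + σ + 3) x (2 ^ (n + κ)))
      (bigN (n + κ) - 1) (ballT κ U T (j + 1) u (2 ^ n)) = some z) :
    n ≤ nTop N ∧ ∃ a b : Fin N, a ≠ b ∧ j ≤ (oracleOf κ U T).level n (a : ℕ) (b : ℕ) ∧
      (oracleOf κ U T).level n (a : ℕ) (b : ℕ) ≤ j + σ + 2 := by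
  -- At least two points are selected because `n + κ ≥ 5`; a single one would give no separated
  -- pair.
  have hpos : 2 ≤ bigN (n + κ) := by
    have := bigN_strictMono.le_apply (x := n + κ)
    omega
  have hex : ∀ x, x ∈ ballT4 κ U T (j + σ + 3) x (2 ^ (n + κ)) := fun x =>
    (mem_ballT4_iff hU hT hκ).2 (Or.inl rfl)
  constructor
  · rw [greedyPoint_eq] at h
    have hne : Finset.Nonempty _ := ⟨z, mem_of_firstMax_eq_some h⟩
    have h1 := card_greedyStep_iterate hex hne
    have h2 := hne.card_pos
    have h3 := Finset.card_le_univ (ballT κ U T (j + 1) u (2 ^ n))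
    rw [Fintype.card_fin] at h3
    have h4 := bigN_strictMono.le_iff_le.1 ((show bigN (n + κ) ≤ N by omega).trans (le_bigN_nTop N))
    omega
  · obtain ⟨m, hm⟩ : ∃ m, bigN (n + κ) - 1 = m + 1 := ⟨bigN (n + κ) - 2, by omega⟩
    rw [hm] at h
    obtain ⟨x, hx, y, hy, hxy⟩ := exists_separated_of_greedyPoint h
    have hne : x ≠ y := fun e => hxy (e ▸ hex x)
    refine ⟨x, y, hne, ?_⟩
    rw [oracle_level hne]
    simp only [ballT, ballT4, Finset.mem_filter, Finset.mem_univ, true_and] at hx hy hxy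
    exact level_near_of_separated hU (four_le_ratio hκ) (hT.ne hne) hx hy hxy

theorem greedyValue_ne_zero_imp {score : Fin N → ℝ} {n : ℕ} {j : ℤ} {u : Fin N}
    (h : greedyValue κ σ U T score n j u ≠ 0) :
    n ≤ nTop N ∧ ∃ a b : Fin N, a ≠ b ∧ j ≤ (oracleOf κ U T).level n (a : ℕ) (b : ℕ) ∧
      (oracleOf κ U T).level n (a : ℕ) (b : ℕ) ≤ j + σ + 2 := by
  unfold greedyValue at h
  split at h
  · exact absurd rfl h
  · next x hx => exact greedyPoint_isSome_imp hU hT hκ hx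

/-! ### The recursion on all indices and the constancy of its rows -/

omit hU hT hκ in
theorem fnj_eq_zero {n : ℕ} {j : ℤ} (h : ¬ (n ≤ nTop N + κ ∧ j < jHigh κ U T + σ + 3)) :
    fnj κ σ U T n j = 0 := by
  rw [fnj, if_neg h]

/-- A nonzero source would have `n ≤ n(T)` and `j ≤ j_n({x,y}) ≤ j_{n(T)}({x,y}) < j(T)`. Outside
the range of the definition all terms therefore vanish, and no case distinction remains. -/
theorem fnj_eq (hN : 2 ≤ N) (n : ℕ) (j : ℤ) (u : Fin N) :
    fnj κ σ U T n j u = max (fnj κ σ U T (n + κ) (j + 1) u)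
      (max (greedyValue κ σ U T (fnj κ σ U T (n + κ) (j + σ + 3)) n j u)
        (fnj κ σ U T n (j + 1) u)) := by
  by_cases h : n ≤ nTop N + κ ∧ j < jHigh κ U T + σ + 3
  · rw [fnj, if_pos h]
  · have hA : greedyValue κ σ U T (fnj κ σ U T (n + κ) (j + σ + 3)) n j u = 0 := by
      by_contra hne
      obtain ⟨h1, a, b, hab, h2, -⟩ := greedyValue_ne_zero_imp hU hT hκ hne
      have h3 := level_mono hU hT hκ hab h1
      have h4 := level_nTop_lt_jHigh hU hT hκ hN hab
      omega
    rw [hA, fnj_eq_zero h, fnj_eq_zero (by omega), fnj_eq_zero (by omega)]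
    simp

theorem fnj_nonneg (hN : 2 ≤ N) (n : ℕ) (j : ℤ) (u : Fin N) : 0 ≤ fnj κ σ U T n j u := by
  obtain ⟨m, hm⟩ : ∃ m : ℕ, jHigh κ U T + σ + 3 ≤ j + m :=
    ⟨(jHigh κ U T + σ + 3 - j).toNat, by omega⟩
  induction m generalizing j with
  | zero =>
    rw [fnj_eq_zero (by omega)]
    rfl
  | succ m ih =>
    rw [fnj_eq hU hT hκ hN]
    exact le_max_of_le_right (le_max_of_le_right (ih (j + 1) (by push_cast at hm; omega)))

theorem fnj_succ_le (hN : 2 ≤ N) (n : ℕ) (j : ℤ) (u : Fin N) :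
    fnj κ σ U T n (j + 1) u ≤ fnj κ σ U T n j u := by
  rw [fnj_eq hU hT hκ hN n j]
  exact le_max_of_le_right (le_max_right _ _)

theorem fnj_antitone (hN : 2 ≤ N) (n : ℕ) (u : Fin N) :
    Antitone fun j => fnj κ σ U T n j u :=
  antitone_int_of_succ_le fun j => fnj_succ_le hU hT hκ hN n j u

/-- The source must vanish on the `N + κ + 1` scales from `j` on. A level triggering it at a scale
`j' ≤ j + N + κ` lies in `[j, j + N + κ + σ + 2]`, which the hypothesis forbids. Diagonal pairs may
be included, as this only strengthens the hypothesis. -/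
theorem fnj_succ_eq (hN : 2 ≤ N) {j : ℤ}
    (h : ∀ n < N + κ + 1, ∀ a b : Fin N, ¬ (j ≤ (oracleOf κ U T).level n (a : ℕ) (b : ℕ) ∧
      (oracleOf κ U T).level n (a : ℕ) (b : ℕ) ≤ j + (N + κ + σ + 2 : ℕ))) (n : ℕ) (u : Fin N) :
    fnj κ σ U T n j u = fnj κ σ U T n (j + 1) u := by
  have hN' := nTop_le N
  refine shift_eq_of_source_eq_zero (n₀ := N + κ) (by omega) (fnj_eq hU hT hκ hN)
    (fnj_nonneg hU hT hκ hN) (fun n j u hn => ?_) (j₁ := j) (j₂ := j + (N + κ + 1 : ℕ))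
    (fun n' j' u' h1 h2 => ?_) (N + κ + 1) n j u (by omega) le_rfl le_rfl
  · rw [fnj_eq_zero (by omega)]
    rfl
  · by_contra hne
    obtain ⟨h3, a, b, -, h4, h5⟩ := greedyValue_ne_zero_imp hU hT hκ hne
    exact h n' (by omega) a b ⟨by omega, by push_cast at h2 ⊢; omega⟩

/-- Above all levels the rows are constant in `j`, and they are zero from `j(T) + σ + 3` on. -/
theorem fnj_eq_zero_of_level_lt (hN : 2 ≤ N) {j : ℤ}
    (h : ∀ n < N + κ + 1, ∀ a b : Fin N, (oracleOf κ U T).level n (a : ℕ) (b : ℕ) < j)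
    (n : ℕ) (u : Fin N) : fnj κ σ U T n j u = 0 := by
  have hstep (m : ℕ) : fnj κ σ U T n (j + m) u = fnj κ σ U T n j u := by
    induction m with
    | zero => simp
    | succ m ih =>
      rw [← ih, fnj_succ_eq hU hT hκ hN (j := j + m)]
      · push_cast
        rw [add_assoc]
      · intro n hn a b hab
        have := h n hn a b
        omega
  rw [← hstep (jHigh κ U T + σ + 3 - j).toNat, fnj_eq_zero (by omega)]
  rfl

/-- Because `r = 2^(κ-3)`, the weight `2^n r^(-j-σ-1)` is an integer power of two, which the machine
forms in one operation. -/
theorem greedyValue_eq {score : Fin N → ℝ} (n : ℕ) (j : ℤ) (u : Fin N) :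
    greedyValue κ σ U T score n j u =
      (firstMax score ((greedyStep score
          (queryBall (oracleOf κ U T).level4 (n + κ) (j + σ + 3)))^[bigN (n + κ) - 1]
        (queryBall (oracleOf κ U T).level n (j + 1) u))).elim 0
      fun x => 2 ^ (n + ((κ - 3 : ℕ) : ℤ) * (-j - σ - 1)) + score x := by
  have h1 : ballT κ U T (j + 1) u (2 ^ n) = queryBall (oracleOf κ U T).level n (j + 1) u := by
    ext b
    rw [mem_ballT_iff hU hT hκ, mem_queryBall]
  have h2 : (fun x => ballT4 κ U T (j + σ + 3) x (2 ^ (n + κ))) =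
      queryBall (oracleOf κ U T).level4 (n + κ) (j + σ + 3) := by
    ext x b
    rw [mem_ballT4_iff hU hT hκ, mem_queryBall]
  have h3 : (2 : ℝ) ^ n * ratio κ ^ (-j - σ - 1) =
      2 ^ (n + ((κ - 3 : ℕ) : ℤ) * (-j - σ - 1)) := by
    rw [zpow_add₀ (by norm_num), zpow_mul, ratio]
    simp
  rw [greedyValue, greedyPoint_eq, h1, h2, h3]
  cases firstMax score _ <;> rfl

end Queries

/-! ### Verification of programs -/

section Programs

variable (O : Oracle) (X : ℕ)

/-- The postcondition transformer of a loop with the given test and body, for at most `m`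
iterations. -/
def loopWp (t : State → Prop) (body : (State → Prop) → State → Prop) (Q : State → Prop) :
    ℕ → State → Prop
  | 0, s => ¬ t s ∧ Q s
  | m + 1, s => (t s → body (loopWp t body Q m) s) ∧ (¬ t s → Q s)

/-- `wp O X c Q s`: started in the memory `s`, the program `c` halts, each run of a loop in it takes
at most `X` iterations, and the final memory satisfies `Q`. -/
def wp : Cmd → (State → Prop) → State → Prop
  | .skip, Q, s => Q s
  | .setInt name i k l e, Q, s =>
      Q ⟨Function.update s.ints (name, i.eval O s, k.eval O s, l.eval O s) (e.eval O s), s.reals⟩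
  | .setReal name i k l e, Q, s =>
      Q ⟨s.ints, Function.update s.reals (name, i.eval O s, k.eval O s, l.eval O s) (e.eval O s)⟩
  | .seq c c', Q, s => wp c (wp c' Q) s
  | .branch t c c', Q, s => (t.holds O s → wp c Q s) ∧ (¬ t.holds O s → wp c' Q s)
  | .loop t c, Q, s => loopWp (t.holds O) (wp c) Q X s

/-- A bound for the running time of a program in which each loop takes at most `X` iterations. -/
noncomputable def costPoly : Cmd → Polynomial ℕ
  | .skip => 1
  | .setInt _ i k l e => Polynomial.C (i.cost + k.cost + l.cost + e.cost + 1)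
  | .setReal _ i k l e => Polynomial.C (i.cost + k.cost + l.cost + e.cost + 1)
  | .seq c c' => costPoly c + costPoly c'
  | .branch t c c' => Polynomial.C t.cost + costPoly c + costPoly c'
  | .loop t c => Polynomial.X * (Polynomial.C t.cost + costPoly c) + Polynomial.C t.cost

/-- The names of the integer cells to which a program writes. -/
def intWrites : Cmd → List ℕ
  | .setInt name _ _ _ _ => [name]
  | .seq c c' => intWrites c ++ intWrites c'
  | .branch _ c c' => intWrites c ++ intWrites c'
  | .loop _ c => intWrites c
  | _ => []

/-- The names of the real cells to which a program writes. -/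
def realWrites : Cmd → List ℕ
  | .setReal name _ _ _ _ => [name]
  | .seq c c' => realWrites c ++ realWrites c'
  | .branch _ c c' => realWrites c ++ realWrites c'
  | .loop _ c => realWrites c
  | _ => []

/-- The memories `s` and `s'` agree outside of the cells to which `c` writes. -/
structure Agree (c : Cmd) (s s' : State) : Prop where
  ints : ∀ name q, name ∉ intWrites c → s'.ints (name, q) = s.ints (name, q)
  reals : ∀ name q, name ∉ realWrites c → s'.reals (name, q) = s.reals (name, q)

variable {O X}

theorem Agree.refl (c : Cmd) (s : State) : Agree c s s := ⟨fun _ _ _ => rfl, fun _ _ _ => rfl⟩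

theorem Agree.trans {c : Cmd} {s s' s'' : State} (h : Agree c s s') (h' : Agree c s' s'') :
    Agree c s s'' :=
  ⟨fun n q hn => (h'.ints n q hn).trans (h.ints n q hn),
    fun n q hn => (h'.reals n q hn).trans (h.reals n q hn)⟩

theorem Agree.mono {c d : Cmd} (hi : intWrites c ⊆ intWrites d) (hr : realWrites c ⊆ realWrites d)
    {s s' : State} (h : Agree c s s') : Agree d s s' :=
  ⟨fun n q hn => h.ints n q fun hc => hn (hi hc), fun n q hn => h.reals n q fun hc => hn (hr hc)⟩

theorem exec_agree {c : Cmd} {s s' : State} {k : ℕ} (h : Exec O c s k s') : Agree c s s' := by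
  induction h with
  | skip s => exact Agree.refl _ _
  | setInt s name i k l e =>
    refine ⟨fun n q hn => Function.update_of_ne ?_ _ _, fun _ _ _ => rfl⟩
    rintro ⟨⟩
    simp [intWrites] at hn
  | setReal s name i k l e =>
    refine ⟨fun _ _ _ => rfl, fun n q hn => Function.update_of_ne ?_ _ _⟩
    rintro ⟨⟩
    simp [realWrites] at hn
  | seq _ _ h h' =>
    exact (h.mono (by simp [intWrites]) (by simp [realWrites])).trans
      (h'.mono (by simp [intWrites]) (by simp [realWrites]))
  | branchTrue _ _ h => exact h.mono (by simp [intWrites]) (by simp [realWrites])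
  | branchFalse _ _ h => exact h.mono (by simp [intWrites]) (by simp [realWrites])
  | loopTrue _ _ _ h h' => exact Agree.trans (h.mono (by simp [intWrites]) (by simp [realWrites])) h'
  | loopFalse _ => exact Agree.refl _ _

/-- Soundness of the calculus. In a loop the cost of one pass is bounded independently of the
memory, so induction on the number of remaining passes gives `X` times that cost plus a final test.
-/
theorem exec_of_wp {c : Cmd} : ∀ {Q : State → Prop} {s : State}, wp O X c Q s →
    ∃ k s', k ≤ (costPoly c).eval X ∧ Exec O c s k s' ∧ Q s' := by
  induction c with
  | skip => exact fun h => ⟨1, _, by simp [costPoly], .skip _, h⟩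
  | setInt name i k l e => exact fun h => ⟨_, _, by simp [costPoly], .setInt .., h⟩
  | setReal name i k l e => exact fun h => ⟨_, _, by simp [costPoly], .setReal .., h⟩
  | seq c c' ih ih' =>
    intro Q s h
    obtain ⟨k, s', hk, hs, h'⟩ := ih h
    obtain ⟨k', s'', hk', hs', h''⟩ := ih' h'
    exact ⟨k + k', s'', by simpa [costPoly] using add_le_add hk hk', .seq hs hs', h''⟩
  | branch t c c' ih ih' =>
    intro Q s h
    by_cases ht : t.holds O s
    · obtain ⟨k, s', hk, hs, h'⟩ := ih (h.1 ht)
      exact ⟨_, s', by simp only [costPoly, Polynomial.eval_add, Polynomial.eval_C]; omega,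
        .branchTrue ht hs, h'⟩
    · obtain ⟨k, s', hk, hs, h'⟩ := ih' (h.2 ht)
      exact ⟨_, s', by simp only [costPoly, Polynomial.eval_add, Polynomial.eval_C]; omega,
        .branchFalse ht hs, h'⟩
  | loop t c ih =>
    intro Q s h
    have key : ∀ (m : ℕ) (s : State), loopWp (t.holds O) (wp O X c) Q m s →
        ∃ k s', k ≤ m * (t.cost + (costPoly c).eval X) + t.cost ∧ Exec O (.loop t c) s k s' ∧
          Q s' := by
      intro m
      induction m with
      | zero => exact fun s h => ⟨_, s, by omega, .loopFalse h.1, h.2⟩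
      | succ m ihm =>
        intro s h
        by_cases ht : t.holds O s
        · obtain ⟨k, s', hk, hs, h'⟩ := ih (h.1 ht)
          obtain ⟨k', s'', hk', hs', h''⟩ := ihm _ h'
          exact ⟨_, s'', by rw [Nat.succ_mul]; omega, .loopTrue ht hs hs', h''⟩
        · exact ⟨_, s, by omega, .loopFalse ht, h.2 ht⟩
    obtain ⟨k, s', hk, hs, h'⟩ := key X s h
    exact ⟨k, s', by simpa [costPoly] using hk, hs, h'⟩

theorem loopWp_mono {t : State → Prop} {body : (State → Prop) → State → Prop}
    (hb : ∀ {Q R : State → Prop}, (∀ s, Q s → R s) → ∀ s, body Q s → body R s)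
    {Q R : State → Prop} (h : ∀ s, Q s → R s) (m : ℕ) :
    ∀ s, loopWp t body Q m s → loopWp t body R m s := by
  induction m with
  | zero => exact fun s hs => ⟨hs.1, h s hs.2⟩
  | succ m ih => exact fun s hs => ⟨fun ht => hb ih s (hs.1 ht), fun ht => h s (hs.2 ht)⟩

theorem wp_mono {c : Cmd} : ∀ {Q R : State → Prop}, (∀ s, Q s → R s) →
    ∀ s, wp O X c Q s → wp O X c R s := by
  induction c with
  | skip => exact fun h s => h s
  | setInt => exact fun h s => h _
  | setReal => exact fun h s => h _
  | seq c c' ih ih' => exact fun h s => ih (fun s => ih' h s) s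
  | branch t c c' ih ih' =>
    exact fun h s hs => ⟨fun ht => ih h s (hs.1 ht), fun ht => ih' h s (hs.2 ht)⟩
  | loop t c ih => exact fun h s => loopWp_mono ih h X s

theorem loopWp_and {t : State → Prop} {body : (State → Prop) → State → Prop} {c : Cmd}
    (hb : ∀ {Q : State → Prop} {s}, body Q s → body (fun s' => Q s' ∧ Agree c s s') s)
    (hm : ∀ {Q R : State → Prop}, (∀ s, Q s → R s) → ∀ s, body Q s → body R s)
    {Q : State → Prop} (m : ℕ) :
    ∀ s, loopWp t body Q m s → loopWp t body (fun s' => Q s' ∧ Agree c s s') m s := by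
  induction m with
  | zero => exact fun s hs => ⟨hs.1, hs.2, Agree.refl _ _⟩
  | succ m ih =>
    refine fun s hs => ⟨fun ht => ?_, fun ht => ⟨hs.2 ht, Agree.refl _ _⟩⟩
    refine hm (fun s' hs' => ?_) s (hb (hs.1 ht))
    exact loopWp_mono hm (fun s'' h'' => ⟨h''.1, hs'.2.trans h''.2⟩) m s' (ih s' hs'.1)

/-- A program changes only the cells to which it writes. -/
theorem wp_agree {c : Cmd} : ∀ {Q : State → Prop} {s : State}, wp O X c Q s →
    wp O X c (fun s' => Q s' ∧ Agree c s s') s := by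
  induction c with
  | skip => exact fun h => ⟨h, Agree.refl _ _⟩
  | setInt name i k l e => exact fun {_ s} h => ⟨h, exec_agree (O := O) (.setInt s name i k l e)⟩
  | setReal name i k l e => exact fun {_ s} h => ⟨h, exec_agree (O := O) (.setReal s name i k l e)⟩
  | seq c c' ih ih' =>
    intro Q s h
    refine wp_mono (c := c) (fun s' hs' => ?_) s (ih h)
    refine wp_mono (fun s'' h'' => ⟨h''.1, ?_⟩) s' (ih' hs'.1)
    exact (hs'.2.mono (by simp [intWrites]) (by simp [realWrites])).trans
      (h''.2.mono (by simp [intWrites]) (by simp [realWrites]))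
  | branch t c c' ih ih' =>
    intro Q s h
    refine ⟨fun ht => wp_mono (fun s' hs' => ⟨hs'.1, ?_⟩) s (ih (h.1 ht)),
      fun ht => wp_mono (fun s' hs' => ⟨hs'.1, ?_⟩) s (ih' (h.2 ht))⟩
    · exact hs'.2.mono (by simp [intWrites]) (by simp [realWrites])
    · exact hs'.2.mono (by simp [intWrites]) (by simp [realWrites])
  | loop t c ih =>
    intro Q s h
    exact loopWp_and (c := .loop t c)
      (fun h => wp_mono (fun s' h' => ⟨h'.1, h'.2.mono (by simp [intWrites])
        (by simp [realWrites])⟩) _ (ih h)) wp_mono X s h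

/-- The rule for a loop whose invariant carries a bound for the number of iterations that are
left. -/
theorem wp_loop {t : Test} {c : Cmd} {Q : State → Prop} (I : ℕ → State → Prop)
    (hstep : ∀ m s, I m s → t.holds O s → 0 < m ∧ wp O X c (fun s' => ∃ m' < m, I m' s') s)
    (hexit : ∀ m s, I m s → ¬ t.holds O s → Q s) {m : ℕ} {s : State} (hm : m ≤ X) (h : I m s) :
    wp O X (.loop t c) Q s := by
  have key : ∀ (M m : ℕ) (s : State), m ≤ M → I m s → loopWp (t.holds O) (wp O X c) Q M s := by
    intro M
    induction M with
    | zero =>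
      intro m s hm h
      have hn : ¬ t.holds O s := fun ht => by
        have := (hstep m s h ht).1
        omega
      exact ⟨hn, hexit m s h hn⟩
    | succ M ih =>
      intro m s hm h
      refine ⟨fun ht => ?_, hexit m s h⟩
      exact wp_mono (fun s' ⟨m', hm', hs'⟩ => ih m' s' (by omega) hs') s (hstep m s h ht).2
  exact key X m s hm h

/-- The scalar integer variable with the given name. -/
def IExp.var (name : ℕ) : IExp := .get name (.const 0) (.const 0) (.const 0)

/-- Assignment to a scalar integer variable. -/
def Cmd.assign (name : ℕ) (e : IExp) : Cmd := .setInt name (.const 0) (.const 0) (.const 0) e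

/-- The value of a scalar integer variable. -/
def State.var (s : State) (name : ℕ) : ℤ := s.ints (name, 0, 0, 0)

/-- The loop `for i = 0, 1, …, hi - 1`. -/
def Cmd.for (i : ℕ) (hi : IExp) (body : Cmd) : Cmd :=
  .seq (.assign i (.const 0))
    (.loop (.ilt (.var i) hi) (.seq body (.assign i (.add (.var i) (.const 1)))))

theorem Agree.var {c : Cmd} {s s' : State} (h : Agree c s s') (name : ℕ)
    (hn : name ∉ intWrites c) : s'.var name = s.var name := h.ints _ _ hn

/-- The memory after an assignment to a scalar integer variable. -/
def State.setVar (s : State) (name : ℕ) (z : ℤ) : State :=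
  ⟨Function.update s.ints (name, 0, 0, 0) z, s.reals⟩

/-- The invariant is stated for the memory after the counter has been set. The relation `Agree`
carries along everything that the loop does not write, so invariants need to mention only what
changes. -/
theorem wp_for {i : ℕ} {hi : IExp} {body : Cmd} {Q : State → Prop} {s₀ : State} {H : ℕ}
    (I : ℕ → State → Prop) (hX : H ≤ X) (hib : i ∉ intWrites body)
    (hhi : ∀ s, Agree (.for i hi body) s₀ s → hi.eval O s = H)
    (h0 : I 0 (s₀.setVar i 0))
    (hstep : ∀ k < H, ∀ s, Agree (.for i hi body) s₀ s → s.var i = k → I k s →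
      wp O X body (fun s' => I (k + 1) (s'.setVar i (k + 1 : ℕ))) s)
    (hexit : ∀ s, Agree (.for i hi body) s₀ s → I H s → Q s) :
    wp O X (.for i hi body) Q s₀ := by
  have hset (s : State) (z : ℤ) : Agree (.for i hi body) s (s.setVar i z) := by
    refine ⟨fun n q hn => Function.update_of_ne ?_ _ _, fun _ _ _ => rfl⟩
    rintro ⟨⟩
    simp [Cmd.for, Cmd.assign, intWrites] at hn
  refine wp_loop (fun m s => ∃ k, k + m = H ∧ Agree (.for i hi body) s₀ s ∧ s.var i = k ∧ I k s)
    ?_ ?_ hX ⟨0, by simp, hset s₀ 0, Function.update_self _ _ _, h0⟩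
  · rintro m s ⟨k, hk, ha, hv, hI⟩ ht
    have ht' : s.var i < hi.eval O s := ht
    rw [hhi s ha, hv] at ht'
    refine ⟨by omega, ?_⟩
    refine wp_mono (c := body) (fun s' hs' => ?_) s (wp_agree (hstep k (by omega) s ha hv hI))
    have hv' : s'.var i + 1 = (k + 1 : ℕ) := by rw [hs'.2.var i hib, hv]; simp
    have ha' : Agree (.for i hi body) s₀ s' := ha.trans
      (hs'.2.mono (by simp [Cmd.for, intWrites]) (by simp [Cmd.for, Cmd.assign, realWrites]))
    refine ⟨m - 1, by omega, k + 1, by omega, ?_⟩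
    change Agree _ s₀ (s'.setVar i (s'.var i + 1)) ∧ (s'.setVar i (s'.var i + 1)).var i = _ ∧
      I (k + 1) (s'.setVar i (s'.var i + 1))
    rw [hv']
    exact ⟨ha'.trans (hset _ _), Function.update_self _ _ _, hs'.1⟩
  · rintro m s ⟨k, hk, ha, hv, hI⟩ ht
    have ht' : ¬ s.var i < hi.eval O s := ht
    rw [hhi s ha, hv] at ht'
    obtain rfl : k = H := by omega
    exact hexit s ha hI

end Programs

/-! ### Memory updates -/

section Memory

variable {O : Oracle} {X : ℕ}

attribute [simp] intWrites realWrites IExp.eval RExp.eval Test.holds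

@[simp] theorem intWrites_assign (name : ℕ) (e : IExp) : intWrites (.assign name e) = [name] := rfl

@[simp] theorem realWrites_assign (name : ℕ) (e : IExp) : realWrites (.assign name e) = [] := rfl

@[simp] theorem intWrites_for (i : ℕ) (hi : IExp) (c : Cmd) :
    intWrites (.for i hi c) = i :: (intWrites c ++ [i]) := rfl

@[simp] theorem realWrites_for (i : ℕ) (hi : IExp) (c : Cmd) :
    realWrites (.for i hi c) = realWrites c := by simp [Cmd.for]

@[simp] theorem IExp.eval_var (s : State) (name : ℕ) : (IExp.var name).eval O s = s.var name := rfl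

/-- The memory after an assignment to an integer cell. -/
def State.setI (s : State) (p : ℕ × ℤ × ℤ × ℤ) (z : ℤ) : State :=
  ⟨Function.update s.ints p z, s.reals⟩

/-- The memory after an assignment to a real cell. -/
noncomputable def State.setR (s : State) (p : ℕ × ℤ × ℤ × ℤ) (x : ℝ) : State :=
  ⟨s.ints, Function.update s.reals p x⟩

@[simp] theorem State.ints_setI (s : State) (p q : ℕ × ℤ × ℤ × ℤ) (z : ℤ) :
    (s.setI p z).ints q = if q = p then z else s.ints q := Function.update_apply ..

@[simp] theorem State.reals_setI (s : State) (p : ℕ × ℤ × ℤ × ℤ) (z : ℤ) :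
    (s.setI p z).reals = s.reals := rfl

@[simp] theorem State.reals_setR (s : State) (p q : ℕ × ℤ × ℤ × ℤ) (x : ℝ) :
    (s.setR p x).reals q = if q = p then x else s.reals q := Function.update_apply ..

@[simp] theorem State.ints_setR (s : State) (p : ℕ × ℤ × ℤ × ℤ) (x : ℝ) :
    (s.setR p x).ints = s.ints := rfl

@[simp] theorem State.ints_setVar (s : State) (n m : ℕ) (q : ℤ × ℤ × ℤ) (z : ℤ) :
    (s.setVar n z).ints (m, q) = if m = n ∧ q = (0, 0, 0) then z else s.ints (m, q) := by
  simp [State.setVar, Function.update_apply]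

@[simp] theorem State.reals_setVar (s : State) (n : ℕ) (z : ℤ) :
    (s.setVar n z).reals = s.reals := rfl

@[simp] theorem State.var_setVar (s : State) (n m : ℕ) (z : ℤ) :
    (s.setVar n z).var m = if m = n then z else s.var m := by
  simp [State.var]

@[simp] theorem State.var_setI (s : State) (n m : ℕ) (q : ℤ × ℤ × ℤ) (z : ℤ) :
    (s.setI (n, q) z).var m = if m = n ∧ (0, 0, 0) = q then z else s.var m := by
  simp [State.var]

@[simp] theorem State.var_setR (s : State) (m : ℕ) (p : ℕ × ℤ × ℤ × ℤ) (x : ℝ) :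
    (s.setR p x).var m = s.var m := rfl

theorem wp_skip {Q : State → Prop} {s : State} : wp O X .skip Q s ↔ Q s := Iff.rfl

theorem wp_seq {c c' : Cmd} {Q : State → Prop} {s : State} :
    wp O X (.seq c c') Q s ↔ wp O X c (wp O X c' Q) s := Iff.rfl

theorem wp_branch {t : Test} {c c' : Cmd} {Q : State → Prop} {s : State} :
    wp O X (.branch t c c') Q s ↔
      (t.holds O s → wp O X c Q s) ∧ (¬ t.holds O s → wp O X c' Q s) := Iff.rfl

theorem wp_assign {name : ℕ} {e : IExp} {Q : State → Prop} {s : State} :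
    wp O X (.assign name e) Q s ↔ Q (s.setVar name (e.eval O s)) := Iff.rfl

theorem wp_setInt {name : ℕ} {i k l e : IExp} {Q : State → Prop} {s : State} :
    wp O X (.setInt name i k l e) Q s ↔
      Q (s.setI (name, i.eval O s, k.eval O s, l.eval O s) (e.eval O s)) := Iff.rfl

theorem wp_setReal {name : ℕ} {i k l : IExp} {e : RExp} {Q : State → Prop} {s : State} :
    wp O X (.setReal name i k l e) Q s ↔
      Q (s.setR (name, i.eval O s, k.eval O s, l.eval O s) (e.eval O s)) := Iff.rfl

/-- Test for equality. -/
def Test.eq (a b : IExp) : Test := .conj (.neg (.ilt a b)) (.neg (.ilt b a))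

@[simp] theorem Test.holds_eq {a b : IExp} {s : State} :
    (Test.eq a b).holds O s ↔ a.eval O s = b.eval O s := by
  simp only [Test.eq, Test.holds]
  omega

/-- The test for `a = b ∨ j ≤ g`. -/
def Test.near (a b j g : IExp) : Test := .neg (.conj (.neg (.eq a b)) (.ilt g j))

@[simp] theorem Test.holds_near {a b j g : IExp} {s : State} :
    (Test.near a b j g).holds O s ↔ a.eval O s = b.eval O s ∨ j.eval O s ≤ g.eval O s := by
  rw [Test.near, Test.holds, Test.holds, Test.holds, Test.holds, Test.holds_eq]
  omega

/-- The expression `m * e`. -/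
def IExp.times : ℕ → IExp → IExp
  | 0, _ => .const 0
  | m + 1, e => .add (IExp.times m e) e

@[simp] theorem IExp.eval_times (s : State) (m : ℕ) (e : IExp) :
    (IExp.times m e).eval O s = m * e.eval O s := by
  induction m with
  | zero => simp [IExp.times]
  | succ m ih => simp [IExp.times, ih, add_mul]

end Memory

/-! ### The table of the numbers `N_n` -/

section Table

variable {O : Oracle} {X : ℕ}

/-- `y` agrees with `x` as long as `x` does not exceed `N`. -/
def Capped (N x : ℕ) (y : ℤ) : Prop := y = x ∨ (N : ℤ) < y ∧ y ≤ x

/-- Doubling of a variable, unless it exceeds the number in the first input cell. -/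
def cappedDouble (name : ℕ) : Cmd :=
  .branch (.ilt (.var 0) (.var name)) .skip (.assign name (.add (.var name) (.var name)))

/-- The upper end of the range of the index `n`. -/
def rangeEnd (κ : ℕ) : IExp := .add (.var 0) (.const (κ + 1 : ℕ))

/-- The program that writes `N_{n+κ}`, capped at `N`, to the array `6`. -/
def tableCmd (κ : ℕ) : Cmd :=
  .seq (.assign 4 (.const (2 ^ κ : ℕ)))
    (.for 7 (rangeEnd κ)
      (.seq (.assign 5 (.const 1))
        (.seq (.for 14 (.var 4) (cappedDouble 5))
          (.seq (.setInt 6 (.var 7) (.const 0) (.const 0) (.var 5)) (cappedDouble 4)))))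

@[simp] theorem intWrites_cappedDouble (name : ℕ) : intWrites (cappedDouble name) = [name] := rfl

@[simp] theorem realWrites_cappedDouble (name : ℕ) : realWrites (cappedDouble name) = [] := rfl

/-- Once the value exceeds `N` it is frozen, so the true double is still an upper bound. The
alternative `y ≤ 2 * N` or unchanged bounds the variable when it later serves as a loop length. -/
theorem wp_cappedDouble {N x name : ℕ} {Q : State → Prop} {s : State}
    (hN : s.var 0 = N) (hx : Capped N x (s.var name))
    (hQ : ∀ y, Capped N (2 * x) y → (y ≤ 2 * N ∨ y = s.var name) → Q (s.setVar name y)) :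
    wp O X (cappedDouble name) Q s := by
  have hself : s.setVar name (s.var name) = s := by
    simp [State.setVar, State.var]
  rw [cappedDouble, wp_branch, wp_skip, wp_assign]
  simp only [Test.holds, IExp.eval_var, IExp.eval, hN]
  unfold Capped at hx hQ
  push_cast at hQ
  refine ⟨fun h => ?_, fun h => hQ _ (by omega) (by omega)⟩
  have := hQ (s.var name) (by omega) (Or.inr rfl)
  rwa [hself] at this

/-- The array `6` holds the numbers `N_{n+κ}`, as far as they do not exceed `N`. -/
def HasTable (κ N : ℕ) (s : State) : Prop :=
  ∀ n < N + κ + 1, ∀ k < N, s.ints (6, n, 0, 0) = (k + 1 : ℕ) ↔ bigN (n + κ) = k + 1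

/-- `N_{n+κ}` arises from `1` by `2^(n+κ)` doublings, too many for large `n`. Capping both the
exponent and the result at the first value above `N` loses nothing: only comparisons with numbers at
most `N` are needed. The term `2^κ` in the bound is the initial exponent. -/
theorem wp_tableCmd {κ N : ℕ} (hκ : 0 < κ) {s₀ : State} (hN : s₀.var 0 = N)
    (hX₁ : N + κ + 1 ≤ X) (hX₂ : 2 * N + 2 ^ κ ≤ X) :
    wp O X (tableCmd κ) (HasTable κ N) s₀ := by
  rw [tableCmd, wp_seq, wp_assign]
  refine wp_for (H := N + κ + 1) (fun m s => Capped N (2 ^ (m + κ)) (s.var 4) ∧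
    s.var 4 ≤ 2 * N + 2 ^ κ ∧ ∀ n < m, ∀ k < N,
      s.ints (6, n, 0, 0) = (k + 1 : ℕ) ↔ bigN (n + κ) = k + 1) hX₁ (by simp) ?_ ?_ ?_ ?_
  · intro s hs
    simp [rangeEnd, hs.var 0, hN]
    ring
  · simp [Capped]
  · rintro m hm s hs hv ⟨h4, h4', htab⟩
    have hN' : s.var 0 = N := by simp [hs.var 0, hN]
    obtain ⟨e, he⟩ : ∃ e : ℕ, s.var 4 = e :=
      Int.eq_ofNat_of_zero_le (by
        unfold Capped at h4
        push_cast at h4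
        have : (0 : ℤ) < 2 ^ (m + κ) := by positivity
        omega)
    rw [wp_seq, wp_assign, wp_seq]
    refine wp_for (H := e) (fun i s' => Capped N (2 ^ i) (s'.var 5)) ?_ (by simp) ?_ ?_ ?_ ?_
    · have : (e : ℤ) ≤ 2 * N + 2 ^ κ := he ▸ h4'
      exact le_trans (by exact_mod_cast this) hX₂
    · intro s' hs'
      simp [hs'.var 4, he]
    · simp [Capped]
    · intro i hi s' hs' _ hI
      refine wp_cappedDouble (by simp [hs'.var 0, hN']) hI fun y hy _ => ?_
      simpa [pow_succ, mul_comm] using hy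
    · intro s' hs' hI
      rw [wp_seq, wp_setInt]
      refine wp_cappedDouble (N := N) (x := 2 ^ (m + κ)) ?_ ?_ fun y hy hy' => ⟨?_, ?_, ?_⟩
      · simp [hs'.var 0, hN']
      · simpa [hs'.var 4] using h4
      · simpa [pow_succ, mul_comm, add_right_comm] using hy
      · simp [hs'.var 4] at hy' ⊢
        have : (0 : ℤ) < 2 ^ κ := by positivity
        omega
      · intro n hn k hk
        have e7 : s'.var 7 = m := by simp [hs'.var 7, hv]
        rcases Nat.lt_succ_iff_lt_or_eq.1 hn with h | rfl
        · rw [← htab n h k hk]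
          have : (n : ℤ) ≠ m := by omega
          simp [e7, this, hs'.ints 6]
        · have hb : bigN (n + κ) = 2 ^ 2 ^ (n + κ) := by
            rw [bigN, if_neg (by omega)]
          rw [hb]
          simp [e7]
          unfold Capped at hI h4
          rw [he] at h4
          rcases hI with hI | hI
          · rw [hI]
            rcases h4 with h4 | h4
            · have : e = 2 ^ (n + κ) := by exact_mod_cast h4
              rw [this]
              norm_cast
            -- Here the exponent itself was capped: `N < e < 2^e`, so both the computed and the true
            -- value exceed `N`, and neither equals `k + 1 ≤ N`.
            · have h5 : N < 2 ^ e := (show N < e by omega).trans Nat.lt_two_pow_self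
              have h6 : 2 ^ e ≤ 2 ^ 2 ^ (n + κ) := Nat.pow_le_pow_right (by norm_num)
                (by exact_mod_cast h4.2)
              constructor
              · intro h
                have : 2 ^ e = k + 1 := by exact_mod_cast h
                omega
              · intro h
                omega
          · have h5 : e ≤ 2 ^ (n + κ) := by
              rcases h4 with h4 | h4
              · exact_mod_cast h4.le
              · exact_mod_cast h4.2
            have h6 : 2 ^ e ≤ 2 ^ 2 ^ (n + κ) := Nat.pow_le_pow_right (by norm_num) h5
            omega
  · rintro s hs ⟨-, -, htab⟩
    exact htab

end Table

/-! ### Running maxima of query answers -/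

section Best

variable {O : Oracle} {X : ℕ}

/-- The loop over all `n < N + κ + 1`, `a < N` and `b < N`. -/
def forTriples (κ : ℕ) (body : Cmd) : Cmd :=
  .for 7 (rangeEnd κ) (.for 8 (.var 0) (.for 9 (.var 0) body))

@[simp] theorem intWrites_forTriples (κ : ℕ) (body : Cmd) :
    intWrites (forTriples κ body) = 7 :: 8 :: 9 :: (intWrites body ++ [9] ++ [8] ++ [7]) := by
  simp [forTriples]

@[simp] theorem realWrites_forTriples (κ : ℕ) (body : Cmd) :
    realWrites (forTriples κ body) = realWrites body := by
  simp [forTriples]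

/-- For loops that only raise the variable 3: `V` records that its value is legitimate, and `C k`
records that index `k` has been taken into account. The latter survives later raises by
monotonicity. -/
theorem wp_for_best {i : ℕ} {hi : IExp} {body : Cmd} {s₀ : State} {H : ℕ} (V : ℤ → Prop)
    (C : ℕ → ℤ → Prop) (hC : ∀ k z z', z ≤ z' → C k z → C k z') (hi3 : i ≠ 3)
    (hX : H ≤ X) (hib : i ∉ intWrites body)
    (hhi : ∀ s, Agree (.for i hi body) s₀ s → hi.eval O s = H)
    (hstep : ∀ k < H, ∀ s, Agree (.for i hi body) s₀ s → s.var i = k → V (s.var 3) →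
      wp O X body (fun s' => V (s'.var 3) ∧ s.var 3 ≤ s'.var 3 ∧ C k (s'.var 3)) s)
    (h : V (s₀.var 3)) :
    wp O X (.for i hi body)
      (fun s' => V (s'.var 3) ∧ s₀.var 3 ≤ s'.var 3 ∧ ∀ k < H, C k (s'.var 3)) s₀ := by
  refine wp_for (H := H)
    (fun m s => V (s.var 3) ∧ s₀.var 3 ≤ s.var 3 ∧ ∀ k < m, C k (s.var 3)) hX hib hhi ?_ ?_ ?_
  · simpa [hi3.symm] using h
  · rintro m hm s hs hv ⟨h1, h2, h3⟩
    refine wp_mono (fun s' hs' => ?_) s (hstep m hm s hs hv h1)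
    simp only [State.var_setVar, if_neg hi3.symm]
    refine ⟨hs'.1, h2.trans hs'.2.1, fun k hk => ?_⟩
    rcases Nat.lt_succ_iff_lt_or_eq.1 hk with h | rfl
    · exact hC k _ _ hs'.2.1 (h3 k h)
    · exact hs'.2.2
  · exact fun s _ hs => hs

theorem wp_forTriples {κ N : ℕ} {body : Cmd} {s₀ : State} (V : ℤ → Prop)
    (C : ℕ → ℕ → ℕ → ℤ → Prop) (hC : ∀ n a b z z', z ≤ z' → C n a b z → C n a b z')
    (hX : N + κ + 1 ≤ X) (hb : intWrites body ⊆ [3]) (hN : s₀.var 0 = N)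
    (hstep : ∀ n < N + κ + 1, ∀ a < N, ∀ b < N, ∀ s, Agree (forTriples κ body) s₀ s →
      s.var 7 = n → s.var 8 = a → s.var 9 = b → V (s.var 3) →
      wp O X body (fun s' => V (s'.var 3) ∧ s.var 3 ≤ s'.var 3 ∧ C n a b (s'.var 3)) s)
    (h : V (s₀.var 3)) :
    wp O X (forTriples κ body) (fun s' => V (s'.var 3) ∧ s₀.var 3 ≤ s'.var 3 ∧
      ∀ n < N + κ + 1, ∀ a < N, ∀ b < N, C n a b (s'.var 3)) s₀ := by
  have hnot (i : ℕ) (hi : i ≠ 3) : i ∉ intWrites body := fun h => by simpa [hi] using hb h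
  have h0 := hnot 0 (by norm_num)
  have h7 := hnot 7 (by norm_num)
  have h8 := hnot 8 (by norm_num)
  have h9 := hnot 9 (by norm_num)
  refine wp_for_best V (fun n z => ∀ a < N, ∀ b < N, C n a b z)
    (fun n z z' hz h a ha b hb => hC n a b z z' hz (h a ha b hb)) (by norm_num) hX (by simp [h7])
    (fun s hs => ?_) (fun n hn s hs hsn hV => ?_) h
  · simp [rangeEnd, hs.var 0 (by simp [h0]), hN]
    ring
  refine wp_for_best V (fun a z => ∀ b < N, C n a b z)
    (fun a z z' hz h b hb => hC n a b z z' hz (h b hb)) (by norm_num) (by omega) (by simp [h8])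
    (fun s' hs' => ?_) (fun a ha s' hs' hsa hV' => ?_) hV
  · simp [hs.var 0 (by simp [h0]), hs'.var 0 (by simp [h0]), hN]
  have hs'₀ := hs.trans (hs'.mono (d := forTriples κ body)
    (fun x hx => by simp at hx ⊢; tauto) (by simp))
  refine wp_for_best V (fun b z => C n a b z)
    (fun b z z' hz h => hC n a b z z' hz h) (by norm_num) (by omega) (by simp [h9])
    (fun s'' hs'' => ?_) (fun b hb s'' hs'' hsb hV'' => ?_) hV'
  · simp [hs'₀.var 0 (by simp [h0]), hs''.var 0 (by simp [h0]), hN]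
  refine hstep n hn a ha b hb s'' ?_ ?_ ?_ hsb hV''
  · exact hs'₀.trans (hs''.mono (d := forTriples κ body)
      (fun x hx => by simp at hx ⊢; tauto) (by simp))
  · rw [hs''.var 7 (by simp [h7]), hs'.var 7 (by simp [h7]), hsn]
  · rw [hs''.var 8 (by simp [h8]), hsa]

/-- The query for the level of the pair `(8, 9)` at `7`. -/
def levelExp : IExp := .level (.var 7) (.var 8) (.var 9)

/-- The program that raises the variable `3` to all values of the levels. -/
def maxLevelCmd (κ : ℕ) : Cmd :=
  forTriples κ (.branch (.ilt (.var 3) levelExp) (.assign 3 levelExp) .skip)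

theorem wp_maxLevelCmd {κ N : ℕ} {s₀ : State} (hX : N + κ + 1 ≤ X) (hN : s₀.var 0 = N) :
    wp O X (maxLevelCmd κ) (fun s' => s₀.var 3 ≤ s'.var 3 ∧
      ∀ n < N + κ + 1, ∀ a < N, ∀ b < N, O.level n a b ≤ s'.var 3) s₀ := by
  refine wp_mono (fun s' h => h.2) _ (wp_forTriples (fun _ => True)
    (fun n a b z => O.level n a b ≤ z) (fun n a b z z' hz h => h.trans hz) hX (by simp) hN
    (fun n _ a _ b _ s _ h7 h8 h9 _ => ?_) trivial)
  rw [wp_branch, wp_assign, wp_skip]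
  simp only [levelExp, Test.holds, IExp.eval, IExp.eval_var, h7, h8, h9, State.var_setVar, if_true]
  exact ⟨fun hlt => ⟨trivial, hlt.le, le_rfl⟩, fun hlt => ⟨trivial, le_rfl, by omega⟩⟩

/-- The points from which a level is at most `K` above. -/
noncomputable def sweepSet (O : Oracle) (N H K : ℕ) : Finset ℤ :=
  (Finset.range H ×ˢ Finset.range N ×ˢ Finset.range N).biUnion fun p =>
    Finset.Icc (O.level p.1 p.2.1 p.2.2 - K) (O.level p.1 p.2.1 p.2.2)

theorem mem_sweepSet {N H K : ℕ} {j : ℤ} : j ∈ sweepSet O N H K ↔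
    ∃ n < H, ∃ a < N, ∃ b < N, O.level n a b - K ≤ j ∧ j ≤ O.level n a b := by
  simp only [sweepSet, Finset.mem_biUnion, Finset.mem_product, Finset.mem_range, Prod.exists,
    Finset.mem_Icc]
  constructor
  · rintro ⟨n, a, b, ⟨hn, ha, hb⟩, h⟩
    exact ⟨n, hn, a, ha, b, hb, h⟩
  · rintro ⟨n, hn, a, ha, b, hb, h⟩
    exact ⟨n, a, b, ⟨hn, ha, hb⟩, h⟩

theorem card_sweepSet_le (N H K : ℕ) : (sweepSet O N H K).card ≤ H * (N * N) * (K + 1) := by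
  refine (Finset.card_biUnion_le_card_mul _ _ (K + 1) fun p _ => ?_).trans ?_
  · rw [Int.card_Icc]
    omega
  · simp

/-- The program that raises the variable `3` to the next element of the sweep set below the
variable `2`, for `K = N + c`. -/
def nextCmd (κ c : ℕ) : Cmd :=
  forTriples κ (.branch (.ilt levelExp (.var 2))
    (.branch (.ilt (.var 3) levelExp) (.assign 3 levelExp) .skip)
    (.branch (.ilt (.sub levelExp (.add (.var 0) (.const c))) (.var 2))
      (.assign 3 (.sub (.var 2) (.const 1))) .skip))

/-- For an answer `L`, the largest element below `j` of the interval `[L - K, L]` is `L` if `L < j`,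
and `j - 1` if `L - K < j ≤ L`. The maximum of these candidates and `t` leaves no element of the
sweep set strictly between itself and `j`. -/
theorem wp_nextCmd {κ c N : ℕ} {s₀ : State} (hX : N + κ + 1 ≤ X) (hN : s₀.var 0 = N) {t j : ℤ}
    (ht : s₀.var 3 = t) (hj : s₀.var 2 = j) (htj : t < j) :
    wp O X (nextCmd κ c) (fun s' => s'.var 3 ∈ insert t (sweepSet O N (N + κ + 1) (N + c)) ∧
      t ≤ s'.var 3 ∧ s'.var 3 < j ∧
      ∀ x, s'.var 3 < x → x < j → x ∉ sweepSet O N (N + κ + 1) (N + c)) s₀ := by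
  have key := wp_forTriples (O := O) (X := X) (κ := κ) (N := N) (s₀ := s₀)
    (body := .branch (.ilt levelExp (.var 2))
      (.branch (.ilt (.var 3) levelExp) (.assign 3 levelExp) .skip)
      (.branch (.ilt (.sub levelExp (.add (.var 0) (.const c))) (.var 2))
        (.assign 3 (.sub (.var 2) (.const 1))) .skip))
    (fun z => z ∈ insert t (sweepSet O N (N + κ + 1) (N + c)) ∧ z < j)
    (fun n a b z => (O.level n a b < j → O.level n a b ≤ z) ∧
      (j ≤ O.level n a b → O.level n a b - (N + c) < j → j - 1 ≤ z))
    (fun n a b z z' hz h => ⟨fun h1 => (h.1 h1).trans hz, fun h1 h2 => (h.2 h1 h2).trans hz⟩)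
    hX (by simp) hN (fun n hn a ha b hb s hs h7 h8 h9 hVs => ?_) ⟨by simp [ht], by omega⟩
  · refine wp_mono (fun s' h => ⟨h.1.1, ?_, h.1.2, fun x hx hxj hmem => ?_⟩) s₀ key
    · rw [← ht]
      exact h.2.1
    · obtain ⟨n, hn, a, ha, b, hb, h1, h2⟩ := mem_sweepSet.1 hmem
      have h3 := h.2.2 n hn a ha b hb
      push_cast at h1
      omega
  · have h0 : s.var 0 = N := by rw [hs.var 0 (by simp), hN]
    have h2 : s.var 2 = j := by rw [hs.var 2 (by simp), hj]
    simp only [wp_branch, wp_assign, wp_skip, levelExp, Test.holds, IExp.eval, IExp.eval_var, h7,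
      h8, h9, h0, h2, State.var_setVar, if_true]
    refine ⟨fun hlt => ⟨fun h => ⟨⟨?_, hlt⟩, by omega, by omega⟩, fun h => ⟨hVs, by omega⟩⟩,
      fun hlt => ⟨fun h => ⟨⟨?_, by omega⟩, by omega, by omega⟩, fun h => ⟨hVs, by omega⟩⟩⟩
    · refine Finset.mem_insert_of_mem (mem_sweepSet.2 ⟨n, hn, a, ha, b, hb, ?_⟩)
      push_cast
      omega
    · refine Finset.mem_insert_of_mem (mem_sweepSet.2 ⟨n, hn, a, ha, b, hb, ?_⟩)
      push_cast
      omega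

/-- The program that writes the largest `-j_0({x, y})` for distinct points `x` and `y` to the
variable `3`. -/
def minLevelCmd : Cmd :=
  .seq (.assign 3 (.sub (.const 0) (.level (.const 0) (.const 0) (.const 1))))
    (.for 8 (.var 0) (.for 9 (.var 0)
      (.branch (.conj (.neg (.eq (.var 8) (.var 9)))
        (.ilt (.var 3) (.sub (.const 0) (.level (.const 0) (.var 8) (.var 9)))))
        (.assign 3 (.sub (.const 0) (.level (.const 0) (.var 8) (.var 9)))) .skip)))

/-- The sign turns the minimum into a running maximum. Equal indices must be skipped, since their
query returns the default `0`; the pair `(0, 1)` is a legitimate start because `N ≥ 2`. -/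
theorem wp_minLevelCmd {N : ℕ} {s₀ : State} (hX : N ≤ X) (hN : s₀.var 0 = N) (h2 : 2 ≤ N) :
    wp O X minLevelCmd (fun s' =>
      (∃ a < N, ∃ b < N, a ≠ b ∧ s'.var 3 = - O.level 0 a b) ∧
      ∀ a < N, ∀ b < N, a ≠ b → - O.level 0 a b ≤ s'.var 3) s₀ := by
  rw [minLevelCmd, wp_seq, wp_assign]
  set V : ℤ → Prop := fun z => ∃ a < N, ∃ b < N, a ≠ b ∧ z = - O.level 0 a b with hV
  refine wp_mono (fun s' h => ⟨h.1, h.2.2⟩) _ (wp_for_best (H := N) V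
    (fun a z => ∀ b < N, a ≠ b → - O.level 0 a b ≤ z)
    (fun a z z' hz h b hb hab => (h b hb hab).trans hz) (by norm_num) hX (by simp)
    (fun s hs => ?_) (fun a ha s hs hsa hVs => ?_) ?_)
  · simp [hs.var 0, hN]
  · refine wp_for_best (H := N) V (fun b z => a ≠ b → - O.level 0 a b ≤ z)
      (fun b z z' hz h hab => (h hab).trans hz) (by norm_num) hX (by simp)
      (fun s' hs' => ?_) (fun b hb s' hs' hsb hVs' => ?_) hVs
    · simp [hs.var 0, hs'.var 0, hN]
    · have h8 : s'.var 8 = a := by simp [hs'.var 8, hsa]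
      simp only [wp_branch, wp_assign, wp_skip, Test.holds, Test.holds_eq, IExp.eval,
        IExp.eval_var, h8, hsb, State.var_setVar, if_true, zero_sub, Nat.cast_inj]
      refine ⟨fun h => ⟨⟨a, ha, b, hb, h.1, rfl⟩, h.2.le, fun _ => le_rfl⟩, fun h => ⟨hVs', le_rfl,
        fun hab => ?_⟩⟩
      by_contra hlt
      exact h ⟨hab, not_le.1 hlt⟩
  · exact ⟨0, by omega, 1, by omega, by norm_num, by simp⟩

end Best

/-! ### The greedy selection as a program -/

section FirstMax

variable {N : ℕ} {score : Fin N → ℝ} {S : Finset (Fin N)} {m : ℕ}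

/-- The points of `S` with index less than `m`. -/
def below (S : Finset (Fin N)) (m : ℕ) : Finset (Fin N) := S.filter fun y => (y : ℕ) < m

theorem mem_below {y : Fin N} : y ∈ below S m ↔ y ∈ S ∧ (y : ℕ) < m := by simp [below]

theorem below_zero : below S 0 = ∅ := by simp [below]

theorem below_self : below S N = S := by simp [below]

theorem below_succ_of_notMem {hm : m < N} (h : ⟨m, hm⟩ ∉ S) : below S (m + 1) = below S m := by
  ext y
  rw [mem_below, mem_below]
  refine and_congr_right fun hy => ⟨fun hlt => ?_, fun hlt => by omega⟩
  have : (y : ℕ) ≠ m := fun e => h (by convert hy; exact e.symm)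
  omega

theorem firstMax_below_succ_of_none {hm : m < N} (h : ⟨m, hm⟩ ∈ S)
    (h0 : firstMax score (below S m) = none) :
    firstMax score (below S (m + 1)) = some ⟨m, hm⟩ := by
  rw [firstMax_eq_none_iff] at h0
  have hy : ∀ y ∈ below S (m + 1), y = ⟨m, hm⟩ := by
    intro y hy
    rw [mem_below] at hy
    have h1 : y ∉ below S m := by simp [h0]
    rw [mem_below] at h1
    have : (y : ℕ) = m := by
      by_contra hne
      exact h1 ⟨hy.1, by omega⟩
    exact Fin.ext this
  rw [firstMax_eq_some_iff]
  refine ⟨mem_below.2 ⟨h, by simp⟩, fun y h => by rw [hy y h], fun y h hlt => ?_⟩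
  rw [hy y h] at hlt
  exact absurd hlt (lt_irrefl _)

theorem firstMax_below_succ_of_lt {hm : m < N} (h : ⟨m, hm⟩ ∈ S) {x : Fin N}
    (h0 : firstMax score (below S m) = some x) (hlt : score x < score ⟨m, hm⟩) :
    firstMax score (below S (m + 1)) = some ⟨m, hm⟩ := by
  rw [firstMax_eq_some_iff] at h0 ⊢
  have hy : ∀ y ∈ below S (m + 1), y = ⟨m, hm⟩ ∨ y ∈ below S m := by
    intro y hy
    rw [mem_below] at hy ⊢
    by_cases hym : (y : ℕ) = m
    · exact Or.inl (Fin.ext hym)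
    · exact Or.inr ⟨hy.1, by omega⟩
  refine ⟨mem_below.2 ⟨h, by simp⟩, fun y hyS => ?_, fun y hyS hym => ?_⟩
  · rcases hy y hyS with rfl | h1
    · exact le_rfl
    · exact (h0.2.1 y h1).trans hlt.le
  · rcases hy y hyS with rfl | h1
    · exact absurd hym (lt_irrefl _)
    · exact (h0.2.1 y h1).trans_lt hlt

/-- On a tie the earlier point stays, in accordance with the choice of the first maximiser. -/
theorem firstMax_below_succ_of_le {hm : m < N} {x : Fin N}
    (h0 : firstMax score (below S m) = some x) (hle : score ⟨m, hm⟩ ≤ score x) :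
    firstMax score (below S (m + 1)) = some x := by
  rw [firstMax_eq_some_iff] at h0 ⊢
  obtain ⟨h1, h2, h3⟩ := h0
  have hx := mem_below.1 h1
  refine ⟨mem_below.2 ⟨hx.1, by omega⟩, fun y hy => ?_, fun y hy hyx => ?_⟩
  · by_cases hym : (y : ℕ) = m
    · rwa [show y = ⟨m, hm⟩ from Fin.ext hym]
    · have := mem_below.1 hy
      exact h2 y (mem_below.2 ⟨this.1, by omega⟩)
  · have := mem_below.1 hy
    have hyx' : (y : ℕ) < x := hyx
    exact h3 y (mem_below.2 ⟨this.1, by omega⟩) hyx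

end FirstMax

/-! ### The program for `A_{n,j}(u)` -/

section GreedyProgram

variable {O : Oracle} {X : ℕ} {κ σ N : ℕ}

/-- The value of `f_{n+κ, j+σ+3}` at a point, for the current indices. -/
def scoreExp (κ σ : ℕ) (y : IExp) : RExp :=
  .get 1 (.add (.var 7) (.const κ)) (.add (.var 3) (.const (σ + 3 : ℕ))) y

/-- The program that selects the first point of maximal score in the set that is stored in the
array `12`. -/
def findMaxCmd (κ σ : ℕ) : Cmd :=
  .seq (.assign 13 (.const (-1)))
    (.for 9 (.var 0)
      (.branch (.ilt (.const 0) (.get 12 (.var 9) (.const 0) (.const 0)))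
        (.branch (.ilt (.var 13) (.const 0)) (.assign 13 (.var 9))
          (.branch (.rlt (scoreExp κ σ (.var 13)) (scoreExp κ σ (.var 9)))
            (.assign 13 (.var 9)) .skip))
        .skip))

@[simp] theorem intWrites_findMaxCmd : intWrites (findMaxCmd κ σ) = [13, 9, 13, 13, 9] := rfl

@[simp] theorem realWrites_findMaxCmd : realWrites (findMaxCmd κ σ) = [] := rfl

/-- The array `12` holds the indicator function of the set `S`. -/
def Holds12 (S : Finset (Fin N)) (s : State) : Prop :=
  ∀ b : Fin N, s.ints (12, (b : ℕ), 0, 0) = if b ∈ S then 1 else 0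

/-- The number that represents an optional point. -/
def encodePoint (o : Option (Fin N)) : ℤ := o.elim (-1) fun x => (x : ℕ)

/-- The score that the current indices refer to. -/
def HasScore (κ σ : ℕ) (score : Fin N → ℝ) (s : State) : Prop :=
  ∀ b : Fin N, s.reals (1, s.var 7 + κ, s.var 3 + (σ + 3 : ℕ), (b : ℕ)) = score b

theorem eval_scoreExp {score : Fin N → ℝ} {s : State} (h : HasScore κ σ score s) {y : IExp}
    {b : Fin N} (hy : y.eval O s = (b : ℕ)) : (scoreExp κ σ y).eval O s = score b := by
  simp only [scoreExp, RExp.eval, IExp.eval, IExp.eval_var, hy]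
  exact h b

theorem wp_findMaxCmd {score : Fin N → ℝ} {S : Finset (Fin N)} {s₀ : State} (hX : N ≤ X)
    (hN : s₀.var 0 = N) (hscore : HasScore κ σ score s₀) (hS : Holds12 S s₀) :
    wp O X (findMaxCmd κ σ) (fun s => s.var 13 = encodePoint (firstMax score S)) s₀ := by
  rw [findMaxCmd, wp_seq, wp_assign]
  refine wp_for (H := N) (fun m s => s.var 13 = encodePoint (firstMax score (below S m)))
    hX (by simp) (fun s hs => by simp [hs.var 0, hN]) ?_ ?_ ?_
  · simp [below_zero, firstMax_eq_none_iff.2, encodePoint]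
  · intro m hm s hs h9 hI
    have hsc : HasScore κ σ score s := by
      intro b
      rw [hs.var 7 (by simp), hs.var 3 (by simp), hs.reals 1 _ (by simp)]
      simpa using hscore b
    have h12 : s.ints (12, m, 0, 0) = if ⟨m, hm⟩ ∈ S then 1 else 0 := by
      rw [hs.ints 12 _ (by simp)]
      simpa using hS ⟨m, hm⟩
    have e9 : (scoreExp κ σ (.var 9)).eval O s = score ⟨m, hm⟩ := eval_scoreExp hsc h9
    simp only [wp_branch, wp_assign, wp_skip, Test.holds, IExp.eval, IExp.eval_var, h9, h12, e9,
      State.var_setVar, if_true, show (13 : ℕ) ≠ 9 by norm_num, if_false]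
    by_cases hmem : (⟨m, hm⟩ : Fin N) ∈ S
    · simp only [hmem, if_true, zero_lt_one, forall_true_left, not_true_eq_false, IsEmpty.forall_iff,
        and_true]
      cases hf : firstMax score (below S m) with
      | none =>
        rw [firstMax_below_succ_of_none hmem hf]
        rw [hf] at hI
        simp [hI, encodePoint]
      | some x =>
        rw [hf] at hI
        have hx : s.var 13 = (x : ℕ) := hI
        have e13 : (scoreExp κ σ (.var 13)).eval O s = score x := eval_scoreExp hsc hx
        rw [e13, hx]
        refine ⟨fun h => by omega, fun _ => ⟨fun h => ?_, fun h => ?_⟩⟩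
        · rw [firstMax_below_succ_of_lt hmem hf h]
          rfl
        · rw [firstMax_below_succ_of_le (hm := hm) hf (not_lt.1 h)]
          rfl
    · rw [below_succ_of_notMem hmem]
      simp [hmem, hI]
  · intro s hs hI
    rwa [below_self] at hI

/-- The program that selects a point, records the value of the selection in the real variable `2`
if this is the right round, and removes the points close to the selected one. -/
def roundCmd (κ σ : ℕ) : Cmd :=
  .seq (findMaxCmd κ σ)
    (.branch (.ilt (.const (-1)) (.var 13))
      (.seq
        (.branch (.eq (.get 6 (.var 7) (.const 0) (.const 0)) (.add (.var 10) (.const 1)))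
          (.setReal 2 (.const 0) (.const 0) (.const 0)
            (.add (.pow2 (.add (.var 7)
                (.times (κ - 3) (.sub (.const (-(σ + 1 : ℕ))) (.var 3)))))
              (scoreExp κ σ (.var 13))))
          .skip)
        (.for 9 (.var 0)
          (.branch (.near (.var 13) (.var 9) (.add (.var 3) (.const (σ + 3 : ℕ)))
              (.level4 (.add (.var 7) (.const κ)) (.var 13) (.var 9)))
            (.setInt 12 (.var 9) (.const 0) (.const 0) (.const 0)) .skip)))
      .skip)

@[simp] theorem intWrites_roundCmd :
    intWrites (roundCmd κ σ) = [13, 9, 13, 13, 9, 9, 12, 9] := rfl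

@[simp] theorem realWrites_roundCmd : realWrites (roundCmd κ σ) = [2] := rfl

/-- The number that the greedy selection yields for the selected point. -/
noncomputable def selectionValue (κ σ : ℕ) (n : ℕ) (j : ℤ) (score : Fin N → ℝ)
    (o : Option (Fin N)) : ℝ :=
  o.elim 0 fun x => 2 ^ (n + ((κ - 3 : ℕ) : ℤ) * (-j - σ - 1)) + score x

/-- Round `m` selects the point number `m + 1`, so its value is recorded exactly when `N_{n+κ} = m +
1`. If the set is already empty nothing is written; the hypothesis `hv'` ensures that the
accumulator then holds the required value `0`. -/
theorem wp_roundCmd {score : Fin N → ℝ} {S : Finset (Fin N)} {s₀ : State} {n m : ℕ} {j : ℤ}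
    (hX : N ≤ X) (hN : s₀.var 0 = N) (hn : s₀.var 7 = n) (hj : s₀.var 3 = j) (hm : s₀.var 10 = m)
    (hmN : m < N) (hnN : n < N + κ + 1)
    (htab : HasTable κ N s₀) (hscore : HasScore κ σ score s₀) (hS : Holds12 S s₀) {v : ℝ}
    (hv : s₀.reals (2, 0, 0, 0) = v) (hv' : bigN (n + κ) = m + 1 → v = 0) :
    wp O X (roundCmd κ σ) (fun s =>
      Holds12 (greedyStep score (queryBall O.level4 (n + κ) (j + σ + 3)) S) s ∧
      s.reals (2, 0, 0, 0) = if bigN (n + κ) = m + 1 then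
        selectionValue κ σ n j score (firstMax score S) else v) s₀ := by
  rw [roundCmd, wp_seq]
  refine wp_mono ?_ _ (wp_agree (wp_findMaxCmd hX hN hscore hS))
  rintro s ⟨h13, hs⟩
  have hv2 : s.reals (2, 0, 0, 0) = v := by rw [hs.reals 2 _ (by simp), hv]
  have hS' : Holds12 S s := fun b => by rw [hs.ints 12 _ (by simp), hS b]
  rw [wp_branch, wp_skip]
  simp only [Test.holds, IExp.eval, IExp.eval_var, h13]
  cases hf : firstMax score S with
  | none =>
    refine ⟨fun h => by simp [encodePoint] at h, fun _ => ⟨?_, ?_⟩⟩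
    · simpa only [greedyStep, hf] using hS'
    · rw [hv2]
      split_ifs with h
      · exact hv' h
      · rfl
  | some x =>
    refine ⟨fun _ => ?_, fun h => by simp [encodePoint] at h; omega⟩
    rw [hf] at h13
    have hx : s.var 13 = (x : ℕ) := h13
    have hsN : s.var 0 = N := by rw [hs.var 0 (by simp), hN]
    have hsn : s.var 7 = n := by rw [hs.var 7 (by simp), hn]
    have hsj : s.var 3 = j := by rw [hs.var 3 (by simp), hj]
    have hsm : s.var 10 = m := by rw [hs.var 10 (by simp), hm]
    have hsc : HasScore κ σ score s := fun b => by
      rw [hsn, hsj, hs.reals 1 _ (by simp)]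
      simpa [hn, hj] using hscore b
    -- The removal loop is verified for an arbitrary accumulator value, so that it covers both
    -- outcomes of the preceding test.
    have hloop : ∀ (w : ℝ) (s₁ : State), s₁.ints = s.ints → s₁.reals (2, 0, 0, 0) = w →
        wp O X (.for 9 (.var 0)
          (.branch (.near (.var 13) (.var 9) (.add (.var 3) (.const (σ + 3 : ℕ)))
              (.level4 (.add (.var 7) (.const κ)) (.var 13) (.var 9)))
            (.setInt 12 (.var 9) (.const 0) (.const 0) (.const 0)) .skip))
        (fun s => Holds12 (greedyStep score (queryBall O.level4 (n + κ) (j + σ + 3)) S) s ∧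
          s.reals (2, 0, 0, 0) = w) s₁ := by
      intro w s₁ hi hr
      have hvar (i : ℕ) : s₁.var i = s.var i := by rw [State.var, hi, State.var]
      refine wp_for (H := N) (fun i s' => ∀ b : Fin N, s'.ints (12, (b : ℕ), 0, 0) =
        if b ∈ S ∧ ((b : ℕ) < i → b ∉ queryBall O.level4 (n + κ) (j + σ + 3) x) then 1 else 0)
        hX (by simp) (fun s' hs' => by simp [hs'.var 0, hvar, hsN]) ?_ ?_ ?_
      · intro b
        simpa [hi] using hS' b
      · intro i hiN s' hs' h9 hI
        have k13 : s'.var 13 = (x : ℕ) := by rw [hs'.var 13 (by simp), hvar, hx]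
        have k3 : s'.var 3 = j := by rw [hs'.var 3 (by simp), hvar, hsj]
        have k7 : s'.var 7 = n := by rw [hs'.var 7 (by simp), hvar, hsn]
        have hiff : ((x : ℕ) : ℤ) = i ∨ j + (σ + 3 : ℕ) ≤ O.level4 (n + κ) (x : ℕ) i ↔
            (⟨i, hiN⟩ : Fin N) ∈ queryBall O.level4 (n + κ) (j + σ + 3) x := by
          rw [mem_queryBall, Fin.ext_iff]
          push_cast
          rw [Nat.cast_inj, ← add_assoc]
        rw [wp_branch, wp_setInt, wp_skip]
        simp only [Test.holds_near, IExp.eval, IExp.eval_var, k13, k3, k7, h9, hiff]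
        refine ⟨fun hin b => ?_, fun hin b => ?_⟩
        · by_cases hb : (b : ℕ) = i
          · obtain rfl : b = ⟨i, hiN⟩ := Fin.ext hb
            simp [hin]
          · have hb' : ((b : ℕ) : ℤ) ≠ i := by exact_mod_cast hb
            have hlt : (b : ℕ) < i + 1 ↔ (b : ℕ) < i := by omega
            simp [hb, hI b, hlt]
        · by_cases hb : (b : ℕ) = i
          · obtain rfl : b = ⟨i, hiN⟩ := Fin.ext hb
            have := hI ⟨i, hiN⟩
            simp only [lt_irrefl, IsEmpty.forall_iff, and_true] at this
            simp [hin, this]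
          · have hlt : (b : ℕ) < i + 1 ↔ (b : ℕ) < i := by omega
            simp [hI b, hlt]
      · intro s' hs' hI
        refine ⟨fun b => ?_, by rw [hs'.reals 2 _ (by simp), hr]⟩
        rw [hI b]
        simp [greedyStep, hf]
    have htab' : s.ints (6, n, 0, 0) = m + 1 ↔ bigN (n + κ) = m + 1 := by
      rw [hs.ints 6 _ (by simp), ← htab n hnN m hmN]
      simp
    have e13 : (scoreExp κ σ (.var 13)).eval O s = score x := eval_scoreExp hsc hx
    rw [wp_seq, wp_branch, wp_setReal, wp_skip]
    simp only [Test.holds_eq, IExp.eval, RExp.eval, IExp.eval_times, IExp.eval_var, hsn, hsm, hsj,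
      htab', e13]
    refine ⟨fun h => ?_, fun h => ?_⟩
    · refine hloop _ _ rfl ?_
      rw [if_pos h]
      simp only [State.reals_setR, if_true, selectionValue, Option.elim]
      congr 3
      push_cast
      ring
    · exact hloop _ s rfl (by rw [if_neg h, hv2])

/-- The program that computes `A_{n,j}(u)` for the current indices, in the real variable `2`. -/
def greedyCmd (κ σ : ℕ) : Cmd :=
  .seq (.for 9 (.var 0)
      (.branch (.near (.var 11) (.var 9) (.add (.var 3) (.const 1))
          (.level (.var 7) (.var 11) (.var 9)))
        (.setInt 12 (.var 9) (.const 0) (.const 0) (.const 1))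
        (.setInt 12 (.var 9) (.const 0) (.const 0) (.const 0))))
    (.seq (.setReal 2 (.const 0) (.const 0) (.const 0) .zero)
      (.for 10 (.var 0) (roundCmd κ σ)))

@[simp] theorem intWrites_greedyCmd :
    intWrites (greedyCmd κ σ) = [9, 12, 12, 9, 10, 13, 9, 13, 13, 9, 9, 12, 9, 10] := rfl

@[simp] theorem realWrites_greedyCmd : realWrites (greedyCmd κ σ) = [2, 2] := rfl

/-- Running `N` rounds is enough: if `N_{n+κ} > N`, the set is exhausted before the decisive round,
and the correct value is the initial `0`. -/
theorem wp_greedyCmd {score : Fin N → ℝ} {s₀ : State} {n : ℕ} {j : ℤ} {u : Fin N}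
    (hX : N ≤ X) (hN : s₀.var 0 = N) (hn : s₀.var 7 = n) (hj : s₀.var 3 = j)
    (hu : s₀.var 11 = (u : ℕ)) (hnN : n < N + κ + 1)
    (htab : HasTable κ N s₀) (hscore : HasScore κ σ score s₀) :
    wp O X (greedyCmd κ σ) (fun s => s.reals (2, 0, 0, 0) = selectionValue κ σ n j score
      (firstMax score ((greedyStep score
        (queryBall O.level4 (n + κ) (j + σ + 3)))^[bigN (n + κ) - 1]
        (queryBall O.level n (j + 1) u)))) s₀ := by
  set S := queryBall O.level n (j + 1) u with hS
  set E := queryBall (N := N) O.level4 (n + κ) (j + σ + 3) with hE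
  have hpos : 1 ≤ bigN (n + κ) :=
    (show 1 ≤ bigN 0 by simp [bigN]).trans (bigN_strictMono.monotone (Nat.zero_le _))
  rw [greedyCmd, wp_seq]
  refine wp_for (H := N) (fun i s' => ∀ b : Fin N, (b : ℕ) < i →
    s'.ints (12, (b : ℕ), 0, 0) = if b ∈ S then 1 else 0)
    hX (by simp) (fun s' hs' => by simp [hs'.var 0, hN]) (by simp) ?_ ?_
  · intro i hi s hs h9 hI
    have k11 : s.var 11 = (u : ℕ) := by rw [hs.var 11 (by simp), hu]
    have k3 : s.var 3 = j := by rw [hs.var 3 (by simp), hj]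
    have k7 : s.var 7 = n := by rw [hs.var 7 (by simp), hn]
    have hiff : ((u : ℕ) : ℤ) = i ∨ j + 1 ≤ O.level n (u : ℕ) i ↔ (⟨i, hi⟩ : Fin N) ∈ S := by
      rw [mem_queryBall, Fin.ext_iff, Nat.cast_inj]
    rw [wp_branch, wp_setInt, wp_setInt]
    simp only [Test.holds_near, IExp.eval, IExp.eval_var, k11, k3, k7, h9, hiff]
    refine ⟨fun hin b hb => ?_, fun hin b hb => ?_⟩
    · by_cases hbi : (b : ℕ) = i
      · obtain rfl : b = ⟨i, hi⟩ := Fin.ext hbi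
        simp [hin]
      · simp [hbi, hI b (by omega)]
    · by_cases hbi : (b : ℕ) = i
      · obtain rfl : b = ⟨i, hi⟩ := Fin.ext hbi
        simp [hin]
      · simp [hbi, hI b (by omega)]
  · intro s hs hI
    have hsN : s.var 0 = N := by rw [hs.var 0 (by simp), hN]
    have hsn : s.var 7 = n := by rw [hs.var 7 (by simp), hn]
    have hsj : s.var 3 = j := by rw [hs.var 3 (by simp), hj]
    rw [wp_seq, wp_setReal]
    refine wp_for (H := N) (fun m s' => Holds12 ((greedyStep score E)^[m] S) s' ∧
      s'.reals (2, 0, 0, 0) = if bigN (n + κ) ≤ m then selectionValue κ σ n j score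
        (firstMax score ((greedyStep score E)^[bigN (n + κ) - 1] S)) else 0)
      hX (by simp) (fun s' hs' => by simp [hs'.var 0, hsN]) ⟨?_, ?_⟩ ?_ ?_
    · intro b
      have hb := hI b b.2
      by_cases hbS : b ∈ S <;> simpa [hbS] using hb
    · simp only [State.reals_setVar, State.reals_setR, IExp.eval, RExp.eval, if_true]
      rw [if_neg (by omega)]
    · rintro m hm s' hs' h10 ⟨hH, hA⟩
      have ht : HasTable κ N s' := fun n' hn' k hk => by
        rw [← htab n' hn' k hk, hs'.ints 6 _ (by simp)]
        simp [hs.ints 6]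
      have hsc : HasScore κ σ score s' := fun b => by
        have := hscore b
        rw [hn, hj] at this
        rw [hs'.var 7 (by simp), hs'.var 3 (by simp), hs'.reals 1 _ (by simp)]
        simpa [hsn, hsj, hs.reals 1] using this
      refine wp_mono ?_ _ (wp_roundCmd (O := O) (X := X) (n := n) (m := m) (j := j) hX
        (by rw [hs'.var 0 (by simp)]; simpa using hsN)
        (by rw [hs'.var 7 (by simp)]; simpa using hsn)
        (by rw [hs'.var 3 (by simp)]; simpa using hsj) h10 hm hnN ht hsc hH hA
        (fun h => if_neg (by omega)))
      rintro s'' ⟨h1, h2⟩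
      refine ⟨?_, ?_⟩
      · intro b
        rw [Function.iterate_succ_apply']
        simpa using h1 b
      · rw [State.reals_setVar, h2]
        by_cases hb : bigN (n + κ) = m + 1
        · rw [if_pos hb, if_pos hb.le, hb, Nat.add_sub_cancel]
        · rw [if_neg hb]
          by_cases hb' : bigN (n + κ) ≤ m
          · rw [if_pos hb', if_pos (by omega)]
          · rw [if_neg hb', if_neg (by omega)]
    · rintro s' hs' ⟨-, hA⟩
      rw [hA]
      split_ifs with hb
      · rfl
      -- A nonempty set after `N_{n+κ} - 1 ≥ N` rounds would need more than `N` points.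
      · have hcard : (greedyStep score E)^[bigN (n + κ) - 1] S = ∅ := by
          by_contra hne
          have hne' := Finset.nonempty_iff_ne_empty.2 hne
          have h1 := card_greedyStep_iterate (excl := E)
            (fun x => mem_queryBall.2 (Or.inl rfl)) hne'
          have h2 := hne'.card_pos
          have h3 := Finset.card_le_univ S
          rw [Fintype.card_fin] at h3
          omega
        rw [hcard, firstMax_eq_none_iff.2 rfl]
        rfl

end GreedyProgram

/-! ### The sweep over the scales -/

section Sweep

variable {O : Oracle} {X : ℕ} {κ σ N : ℕ}

/-- The properties of the functions `f_{n,j}` on which the computation by a sweep over the scales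
relies. -/
structure SweepSpec (O : Oracle) (κ σ : ℕ) (f : ℕ → ℤ → Fin N → ℝ) : Prop where
  eq_max : ∀ n j u, f n j u = max (f (n + κ) (j + 1) u)
    (max (selectionValue κ σ n j (f (n + κ) (j + σ + 3)) (firstMax (f (n + κ) (j + σ + 3))
      ((greedyStep (f (n + κ) (j + σ + 3))
        (queryBall O.level4 (n + κ) (j + σ + 3)))^[bigN (n + κ) - 1]
        (queryBall O.level n (j + 1) u)))) (f n (j + 1) u))
  eq_zero : ∀ n j u, N + κ + 1 ≤ n → f n j u = 0
  eq_zero_of_level_lt : ∀ j, (∀ n < N + κ + 1, ∀ a < N, ∀ b < N, O.level n a b < j) →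
    ∀ n u, f n j u = 0
  eq_succ : ∀ j, j ∉ sweepSet O N (N + κ + 1) (N + (κ + σ + 2)) →
    ∀ n u, f n j u = f n (j + 1) u

/-- Descending from `j`, no scale strictly between `i` and `j` lies in the sweep set, so each of
these rows equals its successor. -/
theorem SweepSpec.eq_of_gap {f : ℕ → ℤ → Fin N → ℝ} (hf : SweepSpec O κ σ f) {i j : ℤ}
    (h : ∀ x, i < x → x < j → x ∉ sweepSet O N (N + κ + 1) (N + (κ + σ + 2))) (n : ℕ)
    (u : Fin N) {x : ℤ} (hix : i < x) (hxj : x ≤ j) : f n x u = f n j u := by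
  obtain ⟨m, hm⟩ : ∃ m : ℕ, x + m = j := ⟨(j - x).toNat, by omega⟩
  induction m generalizing x with
  | zero => rw [← hm]; simp
  | succ m ih =>
    push_cast at hm
    rw [hf.eq_succ x (h x hix (by omega)), ih (by omega) (by omega) (by omega)]

/-- The loop over all `n < N + κ + 1` and all points `u`. -/
def forPoints (κ : ℕ) (body : Cmd) : Cmd := .for 7 (rangeEnd κ) (.for 11 (.var 0) body)

@[simp] theorem intWrites_forPoints (body : Cmd) :
    intWrites (forPoints κ body) = 7 :: (11 :: (intWrites body ++ [11]) ++ [7]) := rfl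

@[simp] theorem realWrites_forPoints (body : Cmd) :
    realWrites (forPoints κ body) = realWrites body := by simp [forPoints]

/-- A loop over all `(n, u)` whose body assigns `g n u` to the cell `(1, n, J, u)` fills the row
`J`. -/
theorem wp_forPoints {body : Cmd} {s₀ : State} {J : ℤ} (g : ℕ → Fin N → ℝ)
    (hX : N + κ + 1 ≤ X) (h0 : 0 ∉ intWrites body) (h7 : 7 ∉ intWrites body)
    (h11 : 11 ∉ intWrites body) (hN : s₀.var 0 = N)
    (hstep : ∀ n < N + κ + 1, ∀ u : Fin N, ∀ s, Agree (forPoints κ body) s₀ s →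
      s.var 7 = n → s.var 11 = (u : ℕ) →
      (∀ n' j' u', j' ≠ J → s.reals (1, n', j', u') = s₀.reals (1, n', j', u')) →
      wp O X body (fun s' => ∀ p : ℤ × ℤ × ℤ, s'.reals (1, p) =
        if p = ((n : ℤ), J, ((u : ℕ) : ℤ)) then g n u else s.reals (1, p)) s) :
    wp O X (forPoints κ body) (fun s =>
      (∀ n' j' u', j' ≠ J → s.reals (1, n', j', u') = s₀.reals (1, n', j', u')) ∧
      (∀ n < N + κ + 1, ∀ u : Fin N, s.reals (1, n, J, (u : ℕ)) = g n u) ∧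
      (∀ n : ℕ, N + κ + 1 ≤ n → ∀ u' j', s.reals (1, n, j', u') = s₀.reals (1, n, j', u'))) s₀ := by
  refine wp_for (H := N + κ + 1) (fun m s =>
      (∀ n' j' u', j' ≠ J → s.reals (1, n', j', u') = s₀.reals (1, n', j', u')) ∧
      (∀ n < m, ∀ u : Fin N, s.reals (1, n, J, (u : ℕ)) = g n u) ∧
      (∀ n : ℕ, N + κ + 1 ≤ n → ∀ u' j', s.reals (1, n, j', u') = s₀.reals (1, n, j', u')))
    hX (by simp [h7]) (fun s hs => ?_) (by simp) ?_ (fun s _ h => h)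
  · simp [rangeEnd, hs.var 0 (by simp [h0]), hN]
    ring
  rintro m hm s hs hs7 ⟨hI1, hI2, hI3⟩
  refine wp_for (H := N) (fun i s' =>
      (∀ n' j' u', j' ≠ J → s'.reals (1, n', j', u') = s₀.reals (1, n', j', u')) ∧
      (∀ n < m, ∀ u : Fin N, s'.reals (1, n, J, (u : ℕ)) = g n u) ∧
      (∀ u : Fin N, (u : ℕ) < i → s'.reals (1, m, J, (u : ℕ)) = g m u) ∧
      (∀ n : ℕ, N + κ + 1 ≤ n → ∀ u' j', s'.reals (1, n, j', u') = s₀.reals (1, n, j', u')))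
    (by omega) (by simp [h11]) (fun s' hs' => ?_) ⟨hI1, hI2, by simp, hI3⟩ ?_ ?_
  · simp [hs.var 0 (by simp [h0]), hs'.var 0 (by simp [h0]), hN]
  · rintro i hi s' hs' hs11 ⟨hJ1, hJ2, hJ3, hJ4⟩
    refine wp_mono (fun s'' h => ?_) _ (hstep m hm ⟨i, hi⟩ s'
      (hs.trans (hs'.mono (d := forPoints κ body) (fun x hx => by simp at hx ⊢; tauto) (by simp)))
      (by rw [hs'.var 7 (by simp [h7]), hs7]) hs11 hJ1)
    simp only [State.reals_setVar, h, Prod.mk.injEq]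
    refine ⟨fun n' j' u' hj => ?_, fun n hn u => ?_, fun u hu => ?_, fun n hn u' j' => ?_⟩
    · rw [if_neg (fun h => hj h.2.1), hJ1 n' j' u' hj]
    · rw [if_neg (fun h => by have := h.1; omega), hJ2 n hn u]
    · by_cases hui : (u : ℕ) = i
      · obtain rfl : u = ⟨i, hi⟩ := Fin.ext hui
        simp
      · rw [if_neg (fun h => hui (by exact_mod_cast h.2.2)), hJ3 u (by omega)]
    · rw [if_neg (fun h => by have := h.1; omega), hJ4 n hn u' j']
  · rintro s' hs' ⟨hJ1, hJ2, hJ3, hJ4⟩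
    refine ⟨hJ1, fun n hn u => ?_, hJ4⟩
    rcases Nat.lt_succ_iff_lt_or_eq.1 hn with h | rfl
    · exact hJ2 n h u
    · exact hJ3 u u.2

/-- The row `j` of the array `1` holds the values `f n j u`. -/
def HasRow (f : ℕ → ℤ → Fin N → ℝ) (j : ℤ) (s : State) : Prop :=
  ∀ (n : ℕ) (u : Fin N), s.reals (1, n, j, (u : ℕ)) = f n j u

/-- The array `1` vanishes outside of the range of the index `n`. -/
def ZeroTail (κ N : ℕ) (s : State) : Prop :=
  ∀ n : ℕ, N + κ + 1 ≤ n → ∀ u j, s.reals (1, n, j, u) = 0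

/-- The program that copies the row of index `2` to the rows below it which are within reach of the
row of index `3`. -/
def copyCmd (κ σ : ℕ) : Cmd :=
  .for 15 (.const (σ + 3 : ℕ))
    (.branch (.ilt (.add (.add (.var 3) (.const 1)) (.var 15)) (.var 2))
      (forPoints κ (.setReal 1 (.var 7) (.add (.add (.var 3) (.const 1)) (.var 15)) (.var 11)
        (.get 1 (.var 7) (.var 2) (.var 11))))
      .skip)

@[simp] theorem intWrites_copyCmd : intWrites (copyCmd κ σ) = [15, 7, 11, 11, 7, 15] := rfl

@[simp] theorem realWrites_copyCmd : realWrites (copyCmd κ σ) = [1] := rfl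

/-- Row `i` reads only rows `i + 1` and `i + σ + 3`. Of the rows in this range, those below `j`
coincide with row `j` and are copied from it. The others are at most `j + σ + 2` because `i < j`,
and are already stored. The cost does not depend on `j - i`. -/
theorem wp_copyCmd {f : ℕ → ℤ → Fin N → ℝ} (hf : SweepSpec O κ σ f) {s₀ : State} {i j : ℤ}
    (hX : N + κ + 1 ≤ X) (hX' : σ + 3 ≤ X) (hN : s₀.var 0 = N) (hi : s₀.var 3 = i)
    (hj : s₀.var 2 = j) (hij : i < j)
    (hgap : ∀ x, i < x → x < j → x ∉ sweepSet O N (N + κ + 1) (N + (κ + σ + 2)))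
    (hrow : ∀ x, j ≤ x → x ≤ j + σ + 2 → HasRow f x s₀) (htail : ZeroTail κ N s₀) :
    wp O X (copyCmd κ σ) (fun s => ZeroTail κ N s ∧
      ∀ x, i < x → x ≤ i + σ + 3 → HasRow f x s) s₀ := by
  refine wp_for (H := σ + 3) (fun k s => ZeroTail κ N s ∧
      (∀ x, j ≤ x → x ≤ j + σ + 2 → HasRow f x s) ∧
      ∀ x, i < x → x ≤ i + k → x < j → HasRow f x s)
    hX' (by simp) (fun s hs => by simp) ⟨htail, hrow, by
      intro x h1 h2
      push_cast at h2
      omega⟩ ?_ ?_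
  · rintro k hk s hs h15 ⟨ht, hr, hc⟩
    have h3 : s.var 3 = i := by rw [hs.var 3 (by simp), hi]
    have h2 : s.var 2 = j := by rw [hs.var 2 (by simp), hj]
    have h0 : s.var 0 = N := by rw [hs.var 0 (by simp), hN]
    rw [wp_branch, wp_skip]
    simp only [Test.holds, IExp.eval, IExp.eval_var, h3, h2, h15]
    refine ⟨fun hlt => ?_, fun hge => ⟨ht, hr, fun x h1 h2 h3 => ?_⟩⟩
    · refine wp_mono ?_ _ (wp_forPoints (O := O) (J := i + 1 + k) (fun n u => f n (i + 1 + k) u) hX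
        (by simp) (by simp) (by simp) h0 fun n hn u s' hs' h7 h11 hrest => ?_)
      · rintro s' ⟨g1, g2, g3⟩
        refine ⟨fun n hn u j' => ?_, fun x hx1 hx2 n u => ?_, fun x hx1 hx2 hx3 n u => ?_⟩
        · rw [State.reals_setVar, g3 n hn, ht n hn]
        · rw [State.reals_setVar, g1 _ _ _ (by omega)]
          exact hr x hx1 hx2 n u
        · rw [State.reals_setVar]
          by_cases hx : x = i + 1 + k
          · subst hx
            by_cases hn : n < N + κ + 1
            · exact g2 n hn u
            · rw [g3 n (not_lt.1 hn), ht n (not_lt.1 hn), hf.eq_zero n _ u (not_lt.1 hn)]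
          · rw [g1 _ _ _ hx]
            exact hc x hx1 (by push_cast at hx2; omega) hx3 n u
      · have k3 : s'.var 3 = i := by rw [hs'.var 3 (by simp), h3]
        have k2 : s'.var 2 = j := by rw [hs'.var 2 (by simp), h2]
        have k15 : s'.var 15 = k := by rw [hs'.var 15 (by simp), h15]
        rw [wp_setReal]
        intro p
        simp only [IExp.eval, RExp.eval, IExp.eval_var, k3, k2, k15, h7, h11, State.reals_setR,
          Prod.mk.injEq, true_and]
        refine if_congr Iff.rfl ?_ rfl
        rw [hrest _ _ _ (by omega), hf.eq_of_gap hgap n u (by omega) hlt.le]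
        exact hr j le_rfl (by omega) n u
    · exact hc x h1 (by push_cast at h2; omega) h3
  · rintro s hs ⟨ht, hr, hc⟩
    refine ⟨ht, fun x h1 h2 => ?_⟩
    by_cases hx : x < j
    · exact hc x h1 (by push_cast; omega) hx
    · exact hr x (by omega) (by omega)

/-- The program that raises the real variable `2` to the value of `e`. -/
def raiseCmd (e : RExp) : Cmd :=
  .branch (.rlt (.get 2 (.const 0) (.const 0) (.const 0)) e)
    (.setReal 2 (.const 0) (.const 0) (.const 0) e) .skip

@[simp] theorem intWrites_raiseCmd (e : RExp) : intWrites (raiseCmd e) = [] := rfl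

@[simp] theorem realWrites_raiseCmd (e : RExp) : realWrites (raiseCmd e) = [2] := rfl

theorem wp_raiseCmd {e : RExp} {Q : State → Prop} {s : State}
    (h : Q (s.setR (2, 0, 0, 0) (max (s.reals (2, 0, 0, 0)) (e.eval O s)))) :
    wp O X (raiseCmd e) Q s := by
  have hself : s.setR (2, 0, 0, 0) (s.reals (2, 0, 0, 0)) = s := by simp [State.setR]
  rw [raiseCmd, wp_branch, wp_setReal, wp_skip]
  simp only [Test.holds, IExp.eval, RExp.eval]
  refine ⟨fun hlt => ?_, fun hle => ?_⟩
  · rwa [max_eq_right hlt.le] at h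
  · rwa [max_eq_left (not_lt.1 hle), hself] at h

/-- The program that computes the row of index `3` from the rows above it. -/
def computeRowCmd (κ σ : ℕ) : Cmd :=
  forPoints κ (.seq (greedyCmd κ σ)
    (.seq (raiseCmd (.get 1 (.add (.var 7) (.const κ)) (.add (.var 3) (.const 1)) (.var 11)))
      (.seq (raiseCmd (.get 1 (.var 7) (.add (.var 3) (.const 1)) (.var 11)))
        (.setReal 1 (.var 7) (.var 3) (.var 11) (.get 2 (.const 0) (.const 0) (.const 0))))))

@[simp] theorem intWrites_computeRowCmd : intWrites (computeRowCmd κ σ) =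
    [7, 11, 9, 12, 12, 9, 10, 13, 9, 13, 13, 9, 9, 12, 9, 10, 11, 7] := rfl

@[simp] theorem realWrites_computeRowCmd :
    realWrites (computeRowCmd κ σ) = [2, 2, 2, 2, 1] := rfl

/-- All reads concern rows strictly above `i`, so filling row `i` in place is harmless. A read at `n
+ κ` beyond the range of the loop finds the zero guaranteed by `ZeroTail`, which is the true value
there. -/
theorem wp_computeRowCmd {f : ℕ → ℤ → Fin N → ℝ} (hf : SweepSpec O κ σ f) {s₀ : State} {i : ℤ}
    (hX : N + κ + 1 ≤ X) (hN : s₀.var 0 = N) (hi : s₀.var 3 = i) (htab : HasTable κ N s₀)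
    (hrow : ∀ x, i < x → x ≤ i + σ + 3 → HasRow f x s₀) (htail : ZeroTail κ N s₀) :
    wp O X (computeRowCmd κ σ) (fun s => ZeroTail κ N s ∧
      ∀ x, i ≤ x → x ≤ i + σ + 3 → HasRow f x s) s₀ := by
  refine wp_mono ?_ _ (wp_forPoints (O := O) (J := i) (fun n u => f n i u) hX (by simp) (by simp)
    (by simp) hN fun n hn u s hs h7 h11 hrest => ?_)
  · rintro s ⟨g1, g2, g3⟩
    refine ⟨fun n hn u j' => by rw [g3 n hn, htail n hn], fun x hx1 hx2 n u => ?_⟩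
    by_cases hx : x = i
    · subst hx
      by_cases hn : n < N + κ + 1
      · exact g2 n hn u
      · rw [g3 n (not_lt.1 hn), htail n (not_lt.1 hn), hf.eq_zero n _ u (not_lt.1 hn)]
    · rw [g1 _ _ _ hx]
      exact hrow x (by omega) hx2 n u
  · have k3 : s.var 3 = i := by rw [hs.var 3 (by simp), hi]
    have k0 : s.var 0 = N := by rw [hs.var 0 (by simp), hN]
    have hr : ∀ x, i < x → x ≤ i + σ + 3 → HasRow f x s := fun x h1 h2 n u => by
      rw [hrest _ _ _ (by omega)]
      exact hrow x h1 h2 n u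
    have htab' : HasTable κ N s := fun n' hn' k hk => by
      rw [hs.ints 6 _ (by simp)]
      exact htab n' hn' k hk
    have hsc : HasScore κ σ (f (n + κ) (i + σ + 3)) s := fun b => by
      rw [h7, k3]
      have := hr (i + σ + 3) (by omega) le_rfl (n + κ) b
      push_cast at this ⊢
      rwa [← add_assoc]
    rw [wp_seq]
    refine wp_mono ?_ _ (wp_agree (wp_greedyCmd (O := O) (by omega) k0 h7 k3 h11 hn htab' hsc))
    rintro s' ⟨hA, hs'⟩
    have l3 : s'.var 3 = i := by rw [hs'.var 3 (by simp), k3]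
    have l7 : s'.var 7 = n := by rw [hs'.var 7 (by simp), h7]
    have l11 : s'.var 11 = (u : ℕ) := by rw [hs'.var 11 (by simp), h11]
    have hF1 : s'.reals (1, (n : ℤ) + κ, i + 1, (u : ℕ)) = f (n + κ) (i + 1) u := by
      rw [hs'.reals 1 _ (by simp)]
      exact_mod_cast hr (i + 1) (by omega) (by omega) (n + κ) u
    have hF2 : s'.reals (1, (n : ℤ), i + 1, (u : ℕ)) = f n (i + 1) u := by
      rw [hs'.reals 1 _ (by simp)]
      exact hr (i + 1) (by omega) (by omega) n u
    refine wp_raiseCmd (wp_raiseCmd ?_)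
    rw [wp_setReal]
    intro p
    simp only [IExp.eval, RExp.eval, IExp.eval_var, State.var_setR, l3, l7, l11, State.reals_setR,
      Prod.mk.injEq, true_and, if_true, hA, hF1, hF2, OfNat.one_ne_ofNat, false_and, if_false]
    refine if_congr Iff.rfl ?_ (hs'.reals 1 _ (by simp))
    rw [hf.eq_max n i u, max_assoc, max_left_comm]

/-- One step of the sweep. -/
def sweepStepCmd (κ σ : ℕ) : Cmd :=
  .seq (.assign 3 (.var 1))
    (.seq (nextCmd κ (κ + σ + 2))
      (.seq (copyCmd κ σ) (.seq (computeRowCmd κ σ) (.assign 2 (.var 3)))))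

@[simp] theorem intWrites_nextCmd (c : ℕ) : intWrites (nextCmd κ c) =
    [7, 8, 9, 3, 3, 9, 8, 7] := rfl

@[simp] theorem realWrites_nextCmd (c : ℕ) : realWrites (nextCmd κ c) = [] := rfl

theorem wp_sweepStepCmd {f : ℕ → ℤ → Fin N → ℝ} (hf : SweepSpec O κ σ f) {s₀ : State} {t j : ℤ}
    (hX : N + κ + 1 ≤ X) (hX' : σ + 3 ≤ X) (hN : s₀.var 0 = N) (ht : s₀.var 1 = t)
    (hj : s₀.var 2 = j) (htj : t < j) (htab : HasTable κ N s₀)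
    (hrow : ∀ x, j ≤ x → x ≤ j + σ + 2 → HasRow f x s₀) (htail : ZeroTail κ N s₀) :
    wp O X (sweepStepCmd κ σ) (fun s => ∃ i,
      i ∈ insert t (sweepSet O N (N + κ + 1) (N + (κ + σ + 2))) ∧ t ≤ i ∧ i < j ∧
      s.var 0 = N ∧ s.var 1 = t ∧ s.var 2 = i ∧ HasTable κ N s ∧
      (∀ x, i ≤ x → x ≤ i + σ + 2 → HasRow f x s) ∧ ZeroTail κ N s) s₀ := by
  rw [sweepStepCmd, wp_seq, wp_assign, wp_seq]
  refine wp_mono ?_ _ (wp_agree (wp_nextCmd (O := O) (t := t) (j := j) hX (by simpa using hN)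
    (by simpa using ht) (by simpa using hj) htj))
  rintro s ⟨⟨hi, hti, hij, hgap⟩, hs⟩
  have hsR : s.reals = s₀.reals := by
    ext ⟨name, p⟩
    rw [hs.reals name p (by simp)]
    rfl
  have hs0 : s.var 0 = N := by rw [hs.var 0 (by simp)]; simpa using hN
  have hs1 : s.var 1 = t := by rw [hs.var 1 (by simp)]; simpa using ht
  have hs2 : s.var 2 = j := by rw [hs.var 2 (by simp)]; simpa using hj
  have hsT : HasTable κ N s := fun n hn k hk => by
    rw [hs.ints 6 _ (by simp)]
    simpa using htab n hn k hk
  rw [wp_seq]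
  refine wp_mono ?_ _ (wp_agree (wp_copyCmd hf hX hX' hs0 rfl hs2 hij hgap
    (fun x h1 h2 n u => by rw [hsR]; exact hrow x h1 h2 n u)
    (fun n hn u j' => by rw [hsR]; exact htail n hn u j')))
  rintro s' ⟨⟨htail', hrow'⟩, hs'⟩
  rw [wp_seq]
  refine wp_mono ?_ _ (wp_agree (wp_computeRowCmd hf (i := s.var 3) hX
    (by rw [hs'.var 0 (by simp), hs0]) (hs'.var 3 (by simp))
    (fun n hn k hk => by rw [hs'.ints 6 _ (by simp)]; exact hsT n hn k hk) hrow' htail'))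
  rintro s'' ⟨⟨htail'', hrow''⟩, hs''⟩
  have h3 : s''.var 3 = s.var 3 := by rw [hs''.var 3 (by simp), hs'.var 3 (by simp)]
  rw [wp_assign]
  refine ⟨s.var 3, hi, hti, hij, ?_, ?_, ?_, ?_, ?_, ?_⟩
  · simp [hs''.var 0, hs'.var 0, hs0]
  · simp [hs''.var 1, hs'.var 1, hs1]
  · simp [h3]
  · intro n hn k hk
    rw [← hsT n hn k hk]
    simp [hs''.ints 6, hs'.ints 6]
  · exact fun x h1 h2 n u => hrow'' x h1 (by omega) n u
  · exact htail''

/-- The program that computes the row whose index is given in the variable `1`. -/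
def sweepCmd (κ σ : ℕ) : Cmd :=
  .seq (tableCmd κ) (.seq (.assign 3 (.var 1)) (.seq (maxLevelCmd κ)
    (.seq (.assign 2 (.add (.var 3) (.const 1)))
      (.loop (.ilt (.var 1) (.var 2)) (sweepStepCmd κ σ)))))

@[simp] theorem intWrites_tableCmd : intWrites (tableCmd κ) = [4, 7, 5, 14, 5, 14, 6, 4, 7] := rfl

@[simp] theorem realWrites_tableCmd : realWrites (tableCmd κ) = [] := rfl

@[simp] theorem intWrites_maxLevelCmd : intWrites (maxLevelCmd κ) = [7, 8, 9, 3, 9, 8, 7] := rfl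

@[simp] theorem realWrites_maxLevelCmd : realWrites (maxLevelCmd κ) = [] := rfl

@[simp] theorem intWrites_sweepCmd : intWrites (sweepCmd κ σ) =
    [4, 7, 5, 14, 5, 14, 6, 4, 7, 3, 7, 8, 9, 3, 9, 8, 7, 2, 3, 7, 8, 9, 3, 3, 9, 8, 7, 15, 7, 11,
      11, 7, 15, 7, 11, 9, 12, 12, 9, 10, 13, 9, 13, 13, 9, 9, 12, 9, 10, 11, 7, 2] := rfl

@[simp] theorem realWrites_sweepCmd : realWrites (sweepCmd κ σ) = [1, 2, 2, 2, 2, 1] := rfl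

/-- The number of elements of `S` below the current row strictly decreases, which bounds the number
of steps by the size of the sweep set plus one. Including `t` in `S` makes the sweep stop exactly at
the target. -/
theorem wp_sweepCmd {f : ℕ → ℤ → Fin N → ℝ} (hf : SweepSpec O κ σ f) {s₀ : State} {t : ℤ}
    (hκ : 0 < κ) (hX₁ : N + κ + 1 ≤ X) (hX₂ : 2 * N + 2 ^ κ ≤ X) (hX₃ : σ + 3 ≤ X)
    (hX₄ : (N + κ + 1) * (N * N) * (N + (κ + σ + 2) + 1) + 1 ≤ X)
    (hN : s₀.var 0 = N) (ht : s₀.var 1 = t) (hzero : ∀ p, s₀.reals (1, p) = 0) :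
    wp O X (sweepCmd κ σ) (HasRow f t) s₀ := by
  set S := insert t (sweepSet O N (N + κ + 1) (N + (κ + σ + 2))) with hS
  rw [sweepCmd, wp_seq]
  refine wp_mono ?_ _ (wp_agree (wp_tableCmd hκ hN hX₁ hX₂))
  rintro s ⟨htab, hs⟩
  have hs0 : s.var 0 = N := by rw [hs.var 0 (by simp), hN]
  have hs1 : s.var 1 = t := by rw [hs.var 1 (by simp), ht]
  rw [wp_seq, wp_assign, wp_seq]
  refine wp_mono ?_ _ (wp_agree (wp_maxLevelCmd hX₁ (by simpa using hs0)))
  rintro s' ⟨⟨hle, hmax⟩, hs'⟩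
  have hs'R : ∀ p, s'.reals (1, p) = 0 := fun p => by
    rw [hs'.reals 1 p (by simp), State.reals_setVar, hs.reals 1 p (by simp), hzero]
  have htle : t ≤ s'.var 3 := by simpa [hs1] using hle
  rw [wp_seq, wp_assign]
  refine wp_loop (fun m s => ∃ j, m = (S.filter (· < j)).card ∧ t ≤ j ∧
      s.var 0 = N ∧ s.var 1 = t ∧ s.var 2 = j ∧ HasTable κ N s ∧
      (∀ x, j ≤ x → x ≤ j + σ + 2 → HasRow f x s) ∧ ZeroTail κ N s)
    (m := (S.filter (· < s'.var 3 + 1)).card) ?_ ?_ ?_ ⟨s'.var 3 + 1, rfl, by omega, ?_⟩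
  · rintro _ s₁ ⟨j, rfl, htj, h0, h1, h2, htb, hrow, htail⟩ hlt
    have hlt' : s₁.var 1 < s₁.var 2 := hlt
    rw [h1, h2] at hlt'
    refine ⟨Finset.card_pos.2 ⟨t, Finset.mem_filter.2 ⟨Finset.mem_insert_self _ _, hlt'⟩⟩, ?_⟩
    refine wp_mono ?_ _ (wp_sweepStepCmd hf hX₁ hX₃ h0 h1 h2 hlt' htb hrow htail)
    rintro s₂ ⟨i, hi, hti, hij, hrest⟩
    refine ⟨_, ?_, i, rfl, hti, hrest⟩
    refine Finset.card_lt_card ⟨fun x hx => ?_, fun hsub => ?_⟩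
    · rw [Finset.mem_filter] at hx ⊢
      exact ⟨hx.1, hx.2.trans hij⟩
    · exact lt_irrefl i (Finset.mem_filter.1 (hsub (Finset.mem_filter.2 ⟨hi, hij⟩))).2
  · rintro _ s₁ ⟨j, -, htj, h0, h1, h2, htb, hrow, htail⟩ hlt
    have hlt' : ¬ s₁.var 1 < s₁.var 2 := hlt
    rw [h1, h2] at hlt'
    exact hrow t (by omega) (by omega)
  · have h1 := (Finset.card_filter_le S (· < s'.var 3 + 1))
    have h2 := Finset.card_insert_le t (sweepSet O N (N + κ + 1) (N + (κ + σ + 2)))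
    rw [← hS] at h2
    have h3 := card_sweepSet_le (O := O) N (N + κ + 1) (N + (κ + σ + 2))
    omega
  · refine ⟨by simp [hs'.var 0, hs0], by simp [hs'.var 1, hs1], by simp, ?_, ?_, ?_⟩
    · intro n hn k hk
      rw [← htab n hn k hk]
      simp [hs'.ints 6]
    · intro x hx _ n u
      -- The starting row lies above all answers, so the untouched zero cells already hold the
      -- correct rows.
      rw [hf.eq_zero_of_level_lt x (fun n hn a ha b hb => by
        have := hmax n hn a ha b hb
        omega)]
      exact hs'R _
    · exact fun n _ u j => hs'R _

end Sweep

/-! ### The three programs -/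

section Final

variable {O : Oracle} {X : ℕ} {κ σ N : ℕ}

theorem sweepSpec_fnj {U : ℕ → ℝ → ℝ} {T : Fin N → Ell2} (hU : IsTailFamily U)
    (hT : Function.Injective T) (hκ : 5 ≤ κ) (hN : 2 ≤ N) :
    SweepSpec (oracleOf κ U T) κ σ (fnj κ σ U T) where
  eq_max n j u := by
    rw [fnj_eq hU hT hκ hN, greedyValue_eq hU hT hκ]
    rfl
  eq_zero n j u hn := by
    have := nTop_le N
    rw [fnj_eq_zero (by omega)]
    rfl
  eq_zero_of_level_lt j h n u :=
    fnj_eq_zero_of_level_lt hU hT hκ hN (fun n hn a b => h n hn a a.2 b b.2) n u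
  eq_succ j h n u := by
    refine fnj_succ_eq hU hT hκ hN (fun n hn a b hab => h ?_) n u
    refine mem_sweepSet.2 ⟨n, hn, a, a.2, b, b.2, ?_⟩
    push_cast at hab ⊢
    omega

/-- The program that writes `j_0(T) - σ - 2` to the variable `1`. -/
def lowCmd (σ : ℕ) : Cmd :=
  .seq minLevelCmd (.assign 1 (.sub (.const (-(σ + 2 : ℕ))) (.var 3)))

@[simp] theorem intWrites_lowCmd : intWrites (lowCmd σ) = [3, 8, 9, 3, 9, 8, 1] := rfl

@[simp] theorem realWrites_lowCmd : realWrites (lowCmd σ) = [] := rfl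

theorem wp_lowCmd {U : ℕ → ℝ → ℝ} {T : Fin N → Ell2} (hU : IsTailFamily U)
    (hT : Function.Injective T) (hκ : 5 ≤ κ) (hN : 2 ≤ N) {s₀ : State} (hX : N ≤ X)
    (h0 : s₀.var 0 = N) :
    wp (oracleOf κ U T) X (lowCmd σ) (fun s => s.var 1 = jLow κ U T - σ - 2) s₀ := by
  rw [lowCmd, wp_seq]
  refine wp_mono ?_ _ (wp_minLevelCmd hX h0 hN)
  rintro s ⟨⟨a, ha, b, hb, hab, h3⟩, hmax⟩
  have hlow : jLow κ U T = - s.var 3 := by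
    refine le_antisymm ?_ ((le_jLow_iff hU hT hκ hN _).2 fun a b hab => ?_)
    · have := (le_jLow_iff hU hT hκ hN _).1 le_rfl ⟨a, ha⟩ ⟨b, hb⟩ (by simpa using hab)
      simp only at this
      omega
    · have := hmax a a.2 b b.2 (fun h => hab (Fin.ext h))
      omega
  rw [wp_assign, hlow]
  simp
  ring

/-- The program that raises the output to all values in the row of index `1` at the point of index
`11`. -/
def maxRowCmd (κ : ℕ) : Cmd :=
  .for 7 (rangeEnd κ)
    (.branch (.rlt (.get 0 (.const 0) (.const 0) (.const 0)) (.get 1 (.var 7) (.var 1) (.var 11)))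
      (.setReal 0 (.const 0) (.const 0) (.const 0) (.get 1 (.var 7) (.var 1) (.var 11))) .skip)

@[simp] theorem intWrites_maxRowCmd : intWrites (maxRowCmd κ) = [7, 7] := rfl

@[simp] theorem realWrites_maxRowCmd : realWrites (maxRowCmd κ) = [0] := rfl

theorem wp_maxRowCmd {f : ℕ → ℤ → Fin N → ℝ} {s₀ : State} {t : ℤ} {u : Fin N}
    (hX : N + κ + 1 ≤ X) (hN : s₀.var 0 = N) (ht : s₀.var 1 = t) (hu : s₀.var 11 = (u : ℕ))
    (hrow : HasRow f t s₀) :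
    wp O X (maxRowCmd κ) (fun s => s₀.reals (0, 0, 0, 0) ≤ s.reals (0, 0, 0, 0) ∧
      (∀ n < N + κ + 1, f n t u ≤ s.reals (0, 0, 0, 0)) ∧
      (s.reals (0, 0, 0, 0) = s₀.reals (0, 0, 0, 0) ∨
        ∃ n < N + κ + 1, s.reals (0, 0, 0, 0) = f n t u)) s₀ := by
  refine wp_for (H := N + κ + 1) (fun m s => s₀.reals (0, 0, 0, 0) ≤ s.reals (0, 0, 0, 0) ∧
      (∀ n < m, f n t u ≤ s.reals (0, 0, 0, 0)) ∧
      (s.reals (0, 0, 0, 0) = s₀.reals (0, 0, 0, 0) ∨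
        ∃ n < N + κ + 1, s.reals (0, 0, 0, 0) = f n t u))
    hX (by simp) (fun s hs => ?_) (by simp) ?_ (fun s _ h => h)
  · simp [rangeEnd, hs.var 0, hN]
    ring
  rintro m hm s hs h7 ⟨h1, h2, h3⟩
  have k1 : s.var 1 = t := by rw [hs.var 1 (by simp), ht]
  have k11 : s.var 11 = (u : ℕ) := by rw [hs.var 11 (by simp), hu]
  have hF : s.reals (1, m, t, (u : ℕ)) = f m t u := by
    rw [hs.reals 1 _ (by simp)]
    exact hrow m u
  rw [wp_branch, wp_setReal, wp_skip]
  simp only [Test.holds, IExp.eval, RExp.eval, IExp.eval_var, h7, k1, k11, hF,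
    State.reals_setVar, State.reals_setR, if_true]
  refine ⟨fun hlt => ⟨h1.trans hlt.le, fun n hn => ?_, Or.inr ⟨m, hm, rfl⟩⟩,
    fun hle => ⟨h1, fun n hn => ?_, h3⟩⟩
  · rcases Nat.lt_succ_iff_lt_or_eq.1 hn with h | rfl
    · exact (h2 n h).trans hlt.le
    · exact le_rfl
  · rcases Nat.lt_succ_iff_lt_or_eq.1 hn with h | rfl
    · exact h2 n h
    · exact not_lt.1 hle

/-- The program for a single value `f_{n,j}(u)`. -/
def evalCmd (κ σ : ℕ) : Cmd :=
  .seq (.assign 1 (.get 0 (.const 2) (.const 0) (.const 0)))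
    (.seq (sweepCmd κ σ)
      (.setReal 0 (.const 0) (.const 0) (.const 0)
        (.get 1 (.get 0 (.const 1) (.const 0) (.const 0)) (.var 1)
          (.get 0 (.const 3) (.const 0) (.const 0)))))

/-- The program for the supremum over all indices, at a given point. -/
def pointCmd (κ σ : ℕ) : Cmd :=
  .seq (lowCmd σ) (.seq (sweepCmd κ σ)
    (.seq (.assign 11 (.get 0 (.const 1) (.const 0) (.const 0))) (maxRowCmd κ)))

/-- The program for the supremum over all indices and all points. -/
def supCmd (κ σ : ℕ) : Cmd :=
  .seq (lowCmd σ) (.seq (sweepCmd κ σ) (.for 11 (.var 0) (maxRowCmd κ)))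

/-- The number of iterations of a loop is at most this polynomial in the number of points. -/
noncomputable def loopPoly (κ σ : ℕ) : Polynomial ℕ :=
  (Polynomial.X + Polynomial.C (κ + 1)) * (Polynomial.X * Polynomial.X) *
    (Polynomial.X + Polynomial.C (κ + σ + 3)) +
    (2 * Polynomial.X + Polynomial.C (2 ^ κ + κ + σ + 3))

theorem eval_loopPoly : (loopPoly κ σ).eval N =
    (N + (κ + 1)) * (N * N) * (N + (κ + σ + 3)) + (2 * N + (2 ^ κ + κ + σ + 3)) := by
  simp [loopPoly]

theorem le_eval_loopPoly (κ σ N : ℕ) : N + κ + 1 ≤ (loopPoly κ σ).eval N := by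
  have : 0 < 2 ^ κ := by positivity
  rw [eval_loopPoly]
  omega

theorem wp_sweepCmd_of_loopPoly {f : ℕ → ℤ → Fin N → ℝ} (hf : SweepSpec O κ σ f) {s₀ : State}
    {t : ℤ} (hκ : 0 < κ) (hN : s₀.var 0 = N) (ht : s₀.var 1 = t)
    (hzero : ∀ p, s₀.reals (1, p) = 0) :
    wp O ((loopPoly κ σ).eval N) (sweepCmd κ σ) (HasRow f t) s₀ := by
  have h2 : 0 < 2 ^ κ := by positivity
  refine wp_sweepCmd hf hκ ?_ ?_ ?_ ?_ hN ht hzero <;> rw [eval_loopPoly]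
  · omega
  · omega
  · omega
  · rw [show N + (κ + 1) = N + κ + 1 by ring, show N + (κ + σ + 3) = N + (κ + σ + 2) + 1 by ring]
    omega

theorem computesWithin_of_wp {c : Cmd} {input : List ℤ} {v : ℝ} {b : ℕ}
    (hb : (costPoly c).eval X ≤ b)
    (h : wp O X c (fun s => s.reals (0, 0, 0, 0) = v) (initState input)) :
    ComputesWithin O c input v b := by
  obtain ⟨k, s, hk, hs, hv⟩ := exec_of_wp h
  exact ⟨k, s, hk.trans hb, hs, hv⟩

theorem exists_computesWithin_of_wp {c : Cmd} {input : List ℤ} {R : ℝ → Prop} {b : ℕ}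
    (hb : (costPoly c).eval X ≤ b)
    (h : wp O X c (fun s => R (s.reals (0, 0, 0, 0))) (initState input)) :
    ∃ v, R v ∧ ComputesWithin O c input v b := by
  obtain ⟨k, s, hk, hs, hv⟩ := exec_of_wp h
  exact ⟨_, hv, k, s, hk.trans hb, hs, rfl⟩

theorem wp_evalCmd {f : ℕ → ℤ → Fin N → ℝ} (hf : SweepSpec O κ σ f) (hκ : 0 < κ) (n : ℕ) (j : ℤ)
    (u : Fin N) :
    wp O ((loopPoly κ σ).eval N) (evalCmd κ σ) (fun s => s.reals (0, 0, 0, 0) = f n j u)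
      (initState [(N : ℤ), (n : ℤ), j, (u : ℕ)]) := by
  rw [evalCmd, wp_seq, wp_assign, wp_seq]
  refine wp_mono ?_ _ (wp_agree (wp_sweepCmd_of_loopPoly hf (t := j) hκ ?_ ?_ fun p => ?_))
  · rintro s ⟨hrow, hs⟩
    have h1 : s.var 1 = j := by
      rw [hs.var 1 (by simp)]
      simp [initState]
    have hn : s.ints (0, 1, 0, 0) = n := by
      rw [hs.ints 0 _ (by simp)]
      simp [initState]
    have hu : s.ints (0, 3, 0, 0) = (u : ℕ) := by
      rw [hs.ints 0 _ (by simp)]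
      simp [initState]
    rw [wp_setReal]
    simp only [IExp.eval, RExp.eval, IExp.eval_var, State.reals_setR, if_true, h1, hn, hu]
    exact hrow n u
  · simp [initState, State.var]
  · simp [initState]
  · simp [initState]

/-- The common beginning of the two supremum programs; the input cells and the output cell pass
through it unchanged. -/
theorem wp_low_sweep {U : ℕ → ℝ → ℝ} {T : Fin N → Ell2} (hU : IsTailFamily U)
    (hT : Function.Injective T) (hκ : 5 ≤ κ) (hN : 2 ≤ N) (l : List ℤ) {c : Cmd}
    {Q : State → Prop}
    (h : ∀ s : State, s.var 0 = N → s.var 1 = jLow κ U T - σ - 2 →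
      HasRow (fnj κ σ U T) (jLow κ U T - σ - 2) s → s.reals (0, 0, 0, 0) = 0 →
      (∀ p, s.ints (0, p) = (initState ((N : ℤ) :: l)).ints (0, p)) →
      wp (oracleOf κ U T) ((loopPoly κ σ).eval N) c Q s) :
    wp (oracleOf κ U T) ((loopPoly κ σ).eval N) (.seq (lowCmd σ) (.seq (sweepCmd κ σ) c)) Q
      (initState ((N : ℤ) :: l)) := by
  rw [wp_seq]
  refine wp_mono ?_ _ (wp_agree (wp_lowCmd hU hT hκ hN (by have := le_eval_loopPoly κ σ N; omega)
    (by simp [initState, State.var])))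
  rintro s ⟨h1, hs⟩
  have h0 : s.var 0 = N := by
    rw [hs.var 0 (by simp)]
    simp [initState, State.var]
  rw [wp_seq]
  refine wp_mono ?_ _ (wp_agree (wp_sweepCmd_of_loopPoly (sweepSpec_fnj hU hT hκ hN)
    (by omega) h0 h1 fun p => ?_))
  · rintro s' ⟨hrow, hs'⟩
    refine h s' (by rw [hs'.var 0 (by simp), h0]) (by rw [hs'.var 1 (by simp), h1]) hrow ?_ ?_
    · rw [hs'.reals 0 _ (by simp), hs.reals 0 _ (by simp)]
      rfl
    · intro p
      rw [hs'.ints 0 _ (by simp), hs.ints 0 _ (by simp)]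
  · rw [hs.reals 1 _ (by simp)]
    rfl

theorem inWindow_low {U : ℕ → ℝ → ℝ} {T : Fin N → Ell2} (hU : IsTailFamily U)
    (hT : Function.Injective T) (hκ : 5 ≤ κ) (hN : 2 ≤ N) {n : ℕ} (hn : n ≤ nTop N + κ) :
    InWindow κ σ U T n (jLow κ U T - σ - 2) := by
  have := jLow_lt_jHigh hU hT hκ hN
  exact ⟨hn, le_rfl, by omega⟩

/-- Monotonicity in `j` reduces the window to its lowest row, which belongs to the window because
`j_0 < j(T)`. The indices between `n(T) + κ` and `N + κ`, over which the programs also maximise,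
contribute only zeros, and `0` is below any upper bound since all values are nonnegative. -/
theorem isLUB_of_row {U : ℕ → ℝ → ℝ} {T : Fin N → Ell2} (hU : IsTailFamily U)
    (hT : Function.Injective T) (hκ : 5 ≤ κ) (hN : 2 ≤ N) {A : Set (Fin N)} (hA : A.Nonempty)
    {v : ℝ} (hle : ∀ n < N + κ + 1, ∀ u ∈ A, fnj κ σ U T n (jLow κ U T - σ - 2) u ≤ v)
    (hmem : v = 0 ∨ ∃ n < N + κ + 1, ∃ u ∈ A, v = fnj κ σ U T n (jLow κ U T - σ - 2) u) :
    IsLUB {y | ∃ n j, ∃ u ∈ A, InWindow κ σ U T n j ∧ y = fnj κ σ U T n j u} v := by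
  have hn := nTop_le N
  constructor
  · rintro _ ⟨n, j, u, hu, hw, rfl⟩
    exact (fnj_antitone hU hT hκ hN n u hw.2.1).trans (hle n (by have := hw.1; omega) u hu)
  · intro w hw
    have h0 : 0 ≤ w := by
      obtain ⟨u, hu⟩ := hA
      exact (fnj_nonneg hU hT hκ hN 0 _ u).trans
        (hw ⟨0, _, u, hu, inWindow_low hU hT hκ hN (Nat.zero_le _), rfl⟩)
    rcases hmem with rfl | ⟨n, hnN, u, hu, rfl⟩
    · exact h0
    · by_cases hnt : n ≤ nTop N + κ
      · exact hw ⟨n, _, u, hu, inWindow_low hU hT hκ hN hnt, rfl⟩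
      · rw [fnj_eq_zero (by omega)]
        exact h0

theorem wp_pointCmd {U : ℕ → ℝ → ℝ} {T : Fin N → Ell2} (hU : IsTailFamily U)
    (hT : Function.Injective T) (hκ : 5 ≤ κ) (hN : 2 ≤ N) (u : Fin N) :
    wp (oracleOf κ U T) ((loopPoly κ σ).eval N) (pointCmd κ σ) (fun s =>
      IsLUB {y | ∃ n j, InWindow κ σ U T n j ∧ y = fnj κ σ U T n j u} (s.reals (0, 0, 0, 0)))
      (initState [(N : ℤ), (u : ℕ)]) := by
  refine wp_low_sweep hU hT hκ hN _ fun s h0 h1 hrow hout hin => ?_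
  have hu : s.ints (0, 1, 0, 0) = (u : ℕ) := by
    rw [hin]
    simp [initState]
  rw [wp_seq, wp_assign]
  refine wp_mono ?_ _ (wp_maxRowCmd (f := fnj κ σ U T) (t := jLow κ U T - σ - 2) (u := u)
    (by have := le_eval_loopPoly κ σ N; omega) (by simpa using h0) (by simpa using h1)
    (by simp [hu]) hrow)
  rintro s' ⟨-, h2, h3⟩
  have := isLUB_of_row hU hT hκ hN (Set.singleton_nonempty u)
    (v := s'.reals (0, 0, 0, 0)) (by simpa using h2) (by simpa [hout] using h3)
  simpa using this

theorem wp_supCmd {U : ℕ → ℝ → ℝ} {T : Fin N → Ell2} (hU : IsTailFamily U)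
    (hT : Function.Injective T) (hκ : 5 ≤ κ) (hN : 2 ≤ N) :
    wp (oracleOf κ U T) ((loopPoly κ σ).eval N) (supCmd κ σ) (fun s =>
      IsLUB {y | ∃ n j u, InWindow κ σ U T n j ∧ y = fnj κ σ U T n j u} (s.reals (0, 0, 0, 0)))
      (initState [(N : ℤ)]) := by
  refine wp_low_sweep hU hT hκ hN _ fun s h0 h1 hrow hout _ => ?_
  refine wp_for (H := N) (fun m s => (∀ n < N + κ + 1, ∀ u : Fin N, (u : ℕ) < m →
      fnj κ σ U T n (jLow κ U T - σ - 2) u ≤ s.reals (0, 0, 0, 0)) ∧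
      (s.reals (0, 0, 0, 0) = 0 ∨ ∃ n < N + κ + 1, ∃ u,
        s.reals (0, 0, 0, 0) = fnj κ σ U T n (jLow κ U T - σ - 2) u))
    (by have := le_eval_loopPoly κ σ N; omega) (by simp) (fun s' hs' => by simp [hs'.var 0, h0])
    (by simp [hout]) ?_ ?_
  · rintro m hm s' hs' h11 ⟨h2, h3⟩
    refine wp_mono ?_ _ (wp_maxRowCmd (f := fnj κ σ U T) (t := jLow κ U T - σ - 2) (u := ⟨m, hm⟩)
      (by have := le_eval_loopPoly κ σ N; omega) (by rw [hs'.var 0 (by simp), h0])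
      (by rw [hs'.var 1 (by simp), h1]) h11
      (fun n u => by rw [hs'.reals 1 _ (by simp)]; exact hrow n u))
    rintro s'' ⟨g1, g2, g3⟩
    rw [State.reals_setVar]
    refine ⟨fun n hn u hu => ?_, ?_⟩
    · by_cases hum : (u : ℕ) = m
      · rw [show u = ⟨m, hm⟩ from Fin.ext hum]
        exact g2 n hn
      · exact (h2 n hn u (by omega)).trans g1
    · rcases g3 with g3 | ⟨n, hn, g3⟩
      · rwa [g3]
      · exact Or.inr ⟨n, hn, _, g3⟩
  · rintro s' hs' ⟨h2, h3⟩
    have := isLUB_of_row hU hT hκ hN (A := Set.univ) ⟨⟨0, by omega⟩, trivial⟩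
      (v := s'.reals (0, 0, 0, 0)) (fun n hn u _ => h2 n hn u u.2) (by simpa using h3)
    simpa using this

end Final

end LogConcaveProcess

open LogConcaveProcess
theorem mainTheorem10 (κ σ : ℕ) (hκ : 5 ≤ κ) :
    ∃ (p : Polynomial ℕ) (cSup cPoint cEval : Cmd),
      ∀ (Ω : Type*) [MeasurableSpace Ω] (P : Measure Ω) [IsProbabilityMeasure P]
        (Y : ℕ → Ω → ℝ) (U : ℕ → ℝ → ℝ),
        (∀ i, Measurable (Y i)) →
        (∀ i, U i = tailExponent P (Y i)) →
        (∀ i, ConvexOn ℝ (Set.Ici 0) (U i)) →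
        (∀ i, U i 1 = 1) →
        ∀ (N : ℕ) (T : Fin N → Ell2), 2 ≤ N → Function.Injective T →
          -- the supremum over `u ∈ T` and all `(n, j)` in the window
          (∃ v : ℝ,
            IsLUB {y | ∃ n j u, InWindow κ σ U T n j ∧ y = fnj κ σ U T n j u} v ∧
            ComputesWithin (oracleOf κ U T) cSup [(N : ℤ)] v (p.eval N)) ∧
          -- the pointwise supremum over all `(n, j)` in the window, at a given `u ∈ T`
          (∀ u : Fin N, ∃ v : ℝ,
            IsLUB {y | ∃ n j, InWindow κ σ U T n j ∧ y = fnj κ σ U T n j u} v ∧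
            ComputesWithin (oracleOf κ U T) cPoint [(N : ℤ), (u : ℕ)] v (p.eval N)) ∧
          -- each single value in the window
          (∀ (n : ℕ) (j : ℤ) (u : Fin N), InWindow κ σ U T n j →
            ComputesWithin (oracleOf κ U T) cEval [(N : ℤ), (n : ℤ), j, (u : ℕ)]
              (fnj κ σ U T n j u) (p.eval N)) := by
  -- The cost bounds are polynomials in the iteration cap, and the cap is `loopPoly` in `N`. The sum
  -- serves all three programs at once.
  refine ⟨(costPoly (supCmd κ σ) + costPoly (pointCmd κ σ) + costPoly (evalCmd κ σ)).comp
    (loopPoly κ σ), supCmd κ σ, pointCmd κ σ, evalCmd κ σ, ?_⟩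
  intro Ω _ P _ Y U _ htail hconv hone N T hN hT
  have hU := isTailFamily_of_tailExponent htail hconv hone
  simp only [Polynomial.eval_comp, Polynomial.eval_add]
  refine ⟨?_, fun u => ?_, fun n j u _ => ?_⟩
  · exact exists_computesWithin_of_wp (by omega) (wp_supCmd hU hT hκ hN)
  · exact exists_computesWithin_of_wp (by omega) (wp_pointCmd hU hT hκ hN u)
  · exact computesWithin_of_wp (by omega)
      (wp_evalCmd (sweepSpec_fnj hU hT hκ hN) (by omega) n j u)
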